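/- Let $k\le n$ and $\mathbb O^{n\times k}=\{X\in\mathbb R^{n\times k}: X^{T}X=I_k\}$. Call a function $F$ on $\mathbb R^{n\times k}$ right unitarily invariant if $F(XQ)=F(X)$ for all $X\in\mathbb R^{n\times k}$ and $Q\in\mathbb O^{k\times k}$. Let $D\in\mathbb R^{n\times k}$ and let $\phi,\psi:\mathbb R^{n\times k}\to\mathbb R$ be right unitarily invariant and continuously differentiable near every point of $\mathbb O^{n\times k}$, with $\psi>0$ on $\mathbb O^{n\times k}$. Put $f(X)=\phi(X)+\psi(X)\,\mathrm{tr}(X^{T}D)$, let $X_*\in\mathbb O^{n\times k}$ be a global maximizer of $f$ on $\mathbb O^{n\times k}$, and assume that $\phi$ and $\psi$ are twice differentiable at $X_*$. Let $X_{*\perp}\in\mathbb R^{n\times(n-k)}$ be such that $[X_*,X_{*\perp}]$ is orthogonal. An admissible coefficient function for $\phi$ is a map $H_\phi:\mathbb R^{n\times k}\to\mathbb R^{n\times n}$ with symmetric values that is right unitarily invariant, continuous at every point of $\mathbb O^{n\times k}$, and satisfies $\frac{\partial\phi(X)}{\partial X}=H_\phi(X)X$ for all $X\in\mathbb O^{n\times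 k}$, where $\frac{\partial\phi(X)}{\partial X}$ is the $n\times k$ matrix of partial derivatives; likewise $H_\psi$ for $\psi$. Given such $H_\phi,H_\psi$, let $$H(X)=H_\phi(X)+\mathrm{tr}(X^{T}D)\,H_\psi(X)+\psi(X)\,(DX^{T}+XD^{T}),$$ let $\mathrm{al}(X)=\{XQ: Q\in\arg\max_{Q\in\mathbb O^{k\times k}} f(XQ)\}$, and let $G(X)=H(\widetilde X)$ with $\widetilde X\in\mathrm{al}(X)$. Then admissible coefficient functions $H_\phi,H_\psi$ that are differentiable at $X_*$ exist, and for every such choice: $\mathrm{rank}(X_*^{T}D)=\mathrm{rank}(D)$; for all $X\in\mathbb R^{n\times k}$ in a neighbourhood of $X_*$ the set $\mathrm{al}(X)$ is nonempty and $G(X)$ does not depend on the choice of $\widetilde X\in\mathrm{al}(X)$; $G$ is Fréchet differentiable at $X_*$; with $\Lambda_*=X_*^{T}G(X_*)X_*$ and $\Lambda_{*\perp}=X_{*\perp}^{T}G(X_*)X_{*\perp}$ one has $$G(X_*)=X_*\Lambda_*X_*^{T}+X_{*\perp}\Lambda_{*\perp}X_{*\perp}^{T};$$ and the linear operator $\mathcal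 Q:\mathbb R^{(n-k)\times k}\to\mathbb R^{(n-k)\times k}$, $$\mathcal Q(Z)=\Lambda_{*\perp}Z-Z\Lambda_*+X_{*\perp}^{T}\,\mathbf DG(X_*)[X_{*\perp}Z]\,X_*,$$ is negative semidefinite: $\mathrm{tr}(Z^{T}\mathcal Q(Z))\le 0$ for all $Z\in\mathbb R^{(n-k)\times k}$. -/

import Mathlib

open Matrix Topology

-- The entrywise sup norm on real matrices. All norms on a finite-dimensional space are
-- equivalent, so (Fréchet) differentiability and derivatives do not depend on this choice.
attribute [local instance] Matrix.normedAddCommGroup Matrix.normedSpace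

/-- The Stiefel manifold of real `n × k` matrices with orthonormal columns. For `n = k` this is
the set of orthogonal `k × k` matrices. -/
def stiefel (n k : ℕ) : Set (Matrix (Fin n) (Fin k) ℝ) :=
  {X | Xᵀ * X = 1}

/-- Right unitary (over the reals: orthogonal) invariance: `F (X Q) = F X` for every matrix `X`
and every orthogonal matrix `Q`. -/
def RightUnitarilyInvariant {n k : ℕ} {α : Type*} (F : Matrix (Fin n) (Fin k) ℝ → α) : Prop :=
  ∀ X : Matrix (Fin n) (Fin k) ℝ, ∀ Q ∈ stiefel k k, F (X * Q) = F X

/-- The gradient of a scalar function of a matrix variable: the matrix of the partial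
derivatives, all entries being treated as independent variables. -/
noncomputable def matrixGradient {n k : ℕ} (φ : Matrix (Fin n) (Fin k) ℝ → ℝ)
    (X : Matrix (Fin n) (Fin k) ℝ) : Matrix (Fin n) (Fin k) ℝ :=
  Matrix.of fun i j => fderiv ℝ φ X (Matrix.single i j 1)

/-- `Hφ` is an admissible coefficient function for `φ`: it is symmetric, right unitarily
invariant, continuous at the points of the Stiefel manifold, and represents the gradient
of `φ` there as `Hφ(X) X`. Such a function is in general not unique. -/
structure IsGradientFactor {n k : ℕ} (φ : Matrix (Fin n) (Fin k) ℝ → ℝ)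
    (Hφ : Matrix (Fin n) (Fin k) ℝ → Matrix (Fin n) (Fin n) ℝ) : Prop where
  isSymm : ∀ X, (Hφ X).IsSymm
  invariant : RightUnitarilyInvariant Hφ
  continuousAt : ∀ X ∈ stiefel n k, ContinuousAt Hφ X
  gradient_eq : ∀ X ∈ stiefel n k, matrixGradient φ X = Hφ X * X

/-- The objective function `f(X) = φ(X) + ψ(X) tr(Xᵀ D)`. -/
noncomputable def objective {n k : ℕ} (φ ψ : Matrix (Fin n) (Fin k) ℝ → ℝ)
    (D X : Matrix (Fin n) (Fin k) ℝ) : ℝ :=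
  φ X + ψ X * (Xᵀ * D).trace

/-- The coefficient matrix
`H(X) = Hφ(X) + tr(Xᵀ D) Hψ(X) + ψ(X) (D Xᵀ + X Dᵀ)` of the eigenvector-dependent
nonlinear eigenvalue problem. -/
noncomputable def coeffMatrix {n k : ℕ} (ψ : Matrix (Fin n) (Fin k) ℝ → ℝ)
    (Hφ Hψ : Matrix (Fin n) (Fin k) ℝ → Matrix (Fin n) (Fin n) ℝ)
    (D X : Matrix (Fin n) (Fin k) ℝ) : Matrix (Fin n) (Fin n) ℝ :=
  Hφ X + (Xᵀ * D).trace • Hψ X + ψ X • (D * Xᵀ + X * Dᵀ)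

/-- The (multi-valued) alignment function: all `X Q` where the orthogonal matrix `Q` maximizes
`f(X Q)` over the orthogonal `k × k` matrices. -/
def alignments {n k : ℕ} (f : Matrix (Fin n) (Fin k) ℝ → ℝ)
    (X : Matrix (Fin n) (Fin k) ℝ) : Set (Matrix (Fin n) (Fin k) ℝ) :=
  {Y | ∃ Q ∈ stiefel k k, IsMaxOn (fun R => f (X * R)) (stiefel k k) Q ∧ Y = X * Q}

open Classical in
/-- The aligned coefficient matrix `G(X) = H(Y)` for an alignment `Y` of `X`. It is written for
all real `n × k` matrices `X`, so that it can be differentiated in the matrix variable; the value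
is meaningful where `H(Y)` is the same for all alignments `Y` of `X`. -/
noncomputable def alignedCoeff {n k : ℕ} (φ ψ : Matrix (Fin n) (Fin k) ℝ → ℝ)
    (Hφ Hψ : Matrix (Fin n) (Fin k) ℝ → Matrix (Fin n) (Fin n) ℝ)
    (D X : Matrix (Fin n) (Fin k) ℝ) : Matrix (Fin n) (Fin n) ℝ :=
  if h : (alignments (objective φ ψ D) X).Nonempty then coeffMatrix ψ Hφ Hψ D h.some else 0

/-- The linear operator `Z ↦ Λ⊥ Z - Z Λ + X⊥ᵀ · DG(X)[X⊥ Z] · X`, where `Λ = Xᵀ G(X) X` and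
`Λ⊥ = X⊥ᵀ G(X) X⊥` (`Xp` stands for `X⊥`) and `DG(X)` is the Fréchet derivative of `G` at `X`. -/
noncomputable def levelShiftOperator {n k : ℕ}
    (G : Matrix (Fin n) (Fin k) ℝ → Matrix (Fin n) (Fin n) ℝ)
    (X : Matrix (Fin n) (Fin k) ℝ) (Xp : Matrix (Fin n) (Fin (n - k)) ℝ) :
    Matrix (Fin (n - k)) (Fin k) ℝ →ₗ[ℝ] Matrix (Fin (n - k)) (Fin k) ℝ where
  toFun Z := (Xpᵀ * G X * Xp) * Z - Z * (Xᵀ * G X * X) + Xpᵀ * fderiv ℝ G X (Xp * Z) * X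
  map_add' Z W := by
    simp only [Matrix.mul_add, Matrix.add_mul, map_add]
    abel
  map_smul' c Z := by
    simp only [Matrix.mul_smul, Matrix.smul_mul, map_smul, RingHom.id_apply, smul_add, smul_sub]

/-! By right invariance, aligning X only maximizes ψ(X) tr((XQ)ᵀD) over Q, so where ψ(X) > 0 an
aligned Y = XQ has YᵀD positive semidefinite. Q need not be unique, but YᵀD is: it is the square
root of DᵀXXᵀD. Let K be the orthogonal projection onto ker D and P(X) = (DᵀXXᵀD + K)^{1/2}. Then P
= YᵀD + K, and where P is invertible, P⁻¹K = K and DK = 0 yield DYᵀ = E X Xᵀ with E = D P⁻¹ Dᵀ.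
Hence H(Y) depends on X alone (`coeffMatrix_eq_kernelCoeff`), and it is differentiable because the
square root is differentiable at positive definite matrices.

P(X_*) is positive definite because ker X_*ᵀD = ker D, which also gives the rank identity. Indeed,
if X_*ᵀDu = 0, reflecting along u yields another maximizer in the orbit of X_*, and comparing the
two stationarity conditions forces Du = 0 (`mulVec_eq_zero_of_maximizer`).

For the operator, φ + ψ (tr P - tr K) is the maximum of f over each orbit, so on the manifold it too
is maximal at X_*. Along X = exp(tA)X_* with A skew, its derivative near t = 0 is tr((AX)ᵀG(X)X).
Differentiability of G at the single point X_* allows a second differentiation at t = 0, and the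
sign of the result for AX_* = X_⊥Z is the claim (`second_order_condition`). -/

/-! ### Matrix calculus and the positive semidefinite square root. -/

-- The existential form confines the C*-norm and the Loewner order behind `CFC.sqrt` to this proof;
-- what leaves it is purely topological and algebraic.
open scoped Matrix.Norms.L2Operator MatrixOrder in
theorem exists_continuous_posSemidef_sqrt (m : ℕ) :
    ∃ sq : Matrix (Fin m) (Fin m) ℝ → Matrix (Fin m) (Fin m) ℝ,
      ContinuousOn sq {A | A.PosSemidef} ∧
      (∀ A, A.PosSemidef → (sq A).PosSemidef ∧ sq A * sq A = A) ∧
      ∀ B, B.PosSemidef → sq (B * B) = B := by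
  refine ⟨CFC.sqrt, ?_, fun A hA => ⟨?_, ?_⟩, fun B hB => ?_⟩
  · have := @CFC.continuousOn_sqrt (Matrix (Fin m) (Fin m) ℝ) _ _ _ _ _ _ _
    simpa [Matrix.nonneg_iff_posSemidef] using this
  · exact Matrix.nonneg_iff_posSemidef.1 (CFC.sqrt_nonneg A)
  · exact CFC.sqrt_mul_sqrt_self A (Matrix.nonneg_iff_posSemidef.2 hA)
  · exact CFC.sqrt_mul_self B (Matrix.nonneg_iff_posSemidef.2 hB)

open scoped Matrix.Norms.Operator in
theorem hasDerivAt_matrix_exp {m : ℕ} (A : Matrix (Fin m) (Fin m) ℝ) (t : ℝ) :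
    HasDerivAt (fun t : ℝ => NormedSpace.exp (t • A)) (A * NormedSpace.exp (t • A)) t :=
  hasDerivAt_exp_smul_const' A t

open scoped Matrix.Norms.Operator in
theorem DifferentiableAt.matrix_inv {E : Type*} [NormedAddCommGroup E] [NormedSpace ℝ E]
    {m : ℕ} {f : E → Matrix (Fin m) (Fin m) ℝ} {x : E} (hf : DifferentiableAt ℝ f x)
    (hx : IsUnit (f x)) : DifferentiableAt ℝ (fun y => (f y)⁻¹) x := by
  simp only [Matrix.nonsing_inv_eq_ringInverse]
  exact hf.inverse hx

/-- Matrix multiplication as a continuous bilinear map. -/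
noncomputable def matrixMulCLM (a b c : ℕ) : Matrix (Fin a) (Fin b) ℝ →L[ℝ]
    Matrix (Fin b) (Fin c) ℝ →L[ℝ] Matrix (Fin a) (Fin c) ℝ :=
  LinearMap.toContinuousBilinearMap
    (LinearMap.mk₂ ℝ (fun A B => A * B) Matrix.add_mul Matrix.smul_mul Matrix.mul_add
      fun c A B => Matrix.mul_smul A c B)

/-- Transposition as a continuous linear map. -/
noncomputable def matrixTransposeCLM (a b : ℕ) :
    Matrix (Fin a) (Fin b) ℝ →L[ℝ] Matrix (Fin b) (Fin a) ℝ :=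
  (Matrix.transposeLinearEquiv (Fin a) (Fin b) ℝ ℝ).toLinearMap.toContinuousLinearMap

/-- The trace as a continuous linear map. -/
noncomputable def matrixTraceCLM (a : ℕ) : Matrix (Fin a) (Fin a) ℝ →L[ℝ] ℝ :=
  (Matrix.traceLinearMap (Fin a) ℝ ℝ).toContinuousLinearMap

theorem HasDerivAt.matrix_mul' {a b c : ℕ} {f : ℝ → Matrix (Fin a) (Fin b) ℝ}
    {g : ℝ → Matrix (Fin b) (Fin c) ℝ} {f' : Matrix (Fin a) (Fin b) ℝ}
    {g' : Matrix (Fin b) (Fin c) ℝ} {t : ℝ} (hf : HasDerivAt f f' t) (hg : HasDerivAt g g' t) :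
    HasDerivAt (fun s => f s * g s) (f t * g' + f' * g t) t :=
  (matrixMulCLM a b c).hasDerivAt_of_bilinear (fun _ => hf) (fun _ => hg)

theorem HasDerivAt.matrix_transpose' {a b : ℕ} {f : ℝ → Matrix (Fin a) (Fin b) ℝ}
    {f' : Matrix (Fin a) (Fin b) ℝ} {t : ℝ} (hf : HasDerivAt f f' t) :
    HasDerivAt (fun s => (f s)ᵀ) f'ᵀ t :=
  (matrixTransposeCLM a b).hasFDerivAt.comp_hasDerivAt t hf

theorem HasDerivAt.matrix_trace' {a : ℕ} {f : ℝ → Matrix (Fin a) (Fin a) ℝ}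
    {f' : Matrix (Fin a) (Fin a) ℝ} {t : ℝ} (hf : HasDerivAt f f' t) :
    HasDerivAt (fun s => (f s).trace) f'.trace t :=
  (matrixTraceCLM a).hasFDerivAt.comp_hasDerivAt t hf

section

variable {E : Type*} [NormedAddCommGroup E] [NormedSpace ℝ E]

theorem DifferentiableAt.matrix_mul' {a b c : ℕ} {f : E → Matrix (Fin a) (Fin b) ℝ}
    {g : E → Matrix (Fin b) (Fin c) ℝ} {x : E}
    (hf : DifferentiableAt ℝ f x) (hg : DifferentiableAt ℝ g x) :
    DifferentiableAt ℝ (fun s => f s * g s) x :=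
  ((matrixMulCLM a b c).hasFDerivAt_of_bilinear hf.hasFDerivAt hg.hasFDerivAt).differentiableAt

theorem DifferentiableAt.matrix_transpose' {a b : ℕ} {f : E → Matrix (Fin a) (Fin b) ℝ}
    {x : E} (hf : DifferentiableAt ℝ f x) : DifferentiableAt ℝ (fun s => (f s)ᵀ) x :=
  (matrixTransposeCLM a b).differentiableAt.comp x hf

theorem DifferentiableAt.matrix_trace' {a : ℕ} {f : E → Matrix (Fin a) (Fin a) ℝ}
    {x : E} (hf : DifferentiableAt ℝ f x) : DifferentiableAt ℝ (fun s => (f s).trace) x :=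
  (matrixTraceCLM a).differentiableAt.comp x hf

theorem ContinuousAt.matrix_mul' {a b c : ℕ} {X : Type*} [TopologicalSpace X]
    {f : X → Matrix (Fin a) (Fin b) ℝ}
    {g : X → Matrix (Fin b) (Fin c) ℝ} {x : X} (hf : ContinuousAt f x) (hg : ContinuousAt g x) :
    ContinuousAt (fun s => f s * g s) x :=
  Filter.Tendsto.comp (continuous_fst.matrix_mul continuous_snd).continuousAt (hf.prodMk_nhds hg)

/-- The Lyapunov operator `X ↦ T X + X T` of a positive definite matrix is injective. -/
theorem Matrix.PosDef.eq_zero_of_mul_add_mul_eq_zero {m : ℕ} {T X : Matrix (Fin m) (Fin m) ℝ}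
    (hT : T.PosDef) (h : T * X + X * T = 0) : X = 0 := by
  have h1 := hT.posSemidef.conjTranspose_mul_mul_same X
  have h2 := hT.posSemidef.mul_mul_conjTranspose_same X
  have h3 : (Xᴴ * T * X).trace + (X * T * Xᴴ).trace = 0 := by
    rw [trace_mul_comm (X * T), Matrix.mul_assoc, ← trace_add, ← Matrix.mul_add, h,
      Matrix.mul_zero, trace_zero]
  have h4 : (Xᴴ * T * X).trace = 0 := by
    have := h1.trace_nonneg; have := h2.trace_nonneg; linarith
  rw [h1.trace_eq_zero_iff] at h4
  ext i j
  by_contra hne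
  have hv : X *ᵥ Pi.single j 1 ≠ 0 := by
    intro h0
    apply hne
    simpa using congrFun h0 i
  have := hT.dotProduct_mulVec_pos hv
  rw [star_mulVec, ← dotProduct_mulVec, mulVec_mulVec, mulVec_mulVec, h4]
    at this
  simp at this

/-- The positive semidefinite square root is differentiable at positive definite matrices. -/
theorem DifferentiableAt.of_posDef_mul_self {m : ℕ} {C S : E → Matrix (Fin m) (Fin m) ℝ} {x : E}
    (hC : DifferentiableAt ℝ C x) (hS : ∀ y, (S y).PosSemidef) (hSC : ∀ y, S y * S y = C y)
    (hx : (S x).PosDef) : DifferentiableAt ℝ S x := by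
  -- Squaring is inverted only locally near `S x`, so continuity is needed first, to keep `S y` on
  -- that branch.
  have hcont : ContinuousAt S x := by
    obtain ⟨sq, hsq, -, hu⟩ := exists_continuous_posSemidef_sqrt m
    have hSe : S = fun y => sq (C y) := by
      funext y
      rw [← hSC, hu _ (hS y)]
    have hpsd : ∀ y, C y ∈ {A : Matrix (Fin m) (Fin m) ℝ | A.PosSemidef} := fun y => by
      have := posSemidef_conjTranspose_mul_self (S y)
      rw [(hS y).isHermitian.eq, hSC] at this
      exact this
    rw [hSe]
    exact (hsq _ (hpsd x)).tendsto.comp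
      (tendsto_nhdsWithin_iff.2 ⟨hC.continuousAt, Filter.Eventually.of_forall hpsd⟩)
  set T := S x with hT
  -- The derivative of squaring at T; its injectivity opens the way to the inverse function theorem.
  let L : Matrix (Fin m) (Fin m) ℝ →ₗ[ℝ] Matrix (Fin m) (Fin m) ℝ :=
    LinearMap.mulLeft ℝ T + LinearMap.mulRight ℝ T
  have hL : Function.Injective L := by
    rw [← LinearMap.ker_eq_bot, LinearMap.ker_eq_bot']
    intro X hX
    exact hx.eq_zero_of_mul_add_mul_eq_zero hX
  let e := (LinearEquiv.ofInjectiveEndo L hL).toContinuousLinearEquiv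
  have hstrict : HasStrictFDerivAt (fun A : Matrix (Fin m) (Fin m) ℝ => A * A)
      (e : Matrix (Fin m) (Fin m) ℝ →L[ℝ] Matrix (Fin m) (Fin m) ℝ) T := by
    have h1 : HasStrictFDerivAt (fun A : Matrix (Fin m) (Fin m) ℝ => (A, A)) _ T :=
      (hasStrictFDerivAt_id (𝕜 := ℝ) T).prodMk (hasStrictFDerivAt_id (𝕜 := ℝ) T)
    have := HasStrictFDerivAt.comp (f := fun A : Matrix (Fin m) (Fin m) ℝ => (A, A)) T
      ((matrixMulCLM m m m).isBoundedBilinearMap.hasStrictFDerivAt (T, T)) h1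
    convert! this using 1
  have hinv : ∀ᶠ y in 𝓝 x, hstrict.localInverse _ _ _ (C y) = S y := by
    filter_upwards [hcont.eventually hstrict.eventually_left_inverse] with y hy
    rw [← hSC y]
    exact hy
  have hg := hstrict.to_localInverse.hasFDerivAt.differentiableAt
  rw [show T * T = C x from hSC x] at hg
  exact (hg.comp x hC).congr_of_eventuallyEq (hinv.mono fun _ h => h.symm)

end

/-! ### Orthogonal matrices, trace maximization and the kernel projection. -/

section Stiefel

variable {n k m : ℕ}

theorem mem_stiefel_iff {X : Matrix (Fin n) (Fin k) ℝ} : X ∈ stiefel n k ↔ Xᵀ * X = 1 :=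
  Iff.rfl

theorem mul_mem_stiefel {X : Matrix (Fin n) (Fin k) ℝ} {Q : Matrix (Fin k) (Fin m) ℝ}
    (hX : X ∈ stiefel n k) (hQ : Q ∈ stiefel k m) : X * Q ∈ stiefel n m := by
  simp only [mem_stiefel_iff] at *
  rw [transpose_mul, Matrix.mul_assoc, ← Matrix.mul_assoc Xᵀ, hX, Matrix.one_mul, hQ]

theorem one_mem_stiefel : (1 : Matrix (Fin m) (Fin m) ℝ) ∈ stiefel m m := by
  simp [stiefel]

theorem mul_transpose_of_mem_stiefel {Q : Matrix (Fin m) (Fin m) ℝ} (hQ : Q ∈ stiefel m m) :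
    Q * Qᵀ = 1 :=
  mul_eq_one_comm.1 hQ

theorem exp_smul_mem_stiefel {A : Matrix (Fin m) (Fin m) ℝ} (hA : Aᵀ = -A) (t : ℝ) :
    NormedSpace.exp (t • A) ∈ stiefel m m := by
  simp only [mem_stiefel_iff]
  rw [← Matrix.exp_transpose, transpose_smul, hA, smul_neg, Matrix.exp_neg]
  exact nonsing_inv_mul _ ((Matrix.isUnit_iff_isUnit_det _).1 (Matrix.isUnit_exp _))

/-- The Householder reflection along `u`. -/
noncomputable def householder (u : Fin m → ℝ) : Matrix (Fin m) (Fin m) ℝ :=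
  1 - (2 / (u ⬝ᵥ u)) • vecMulVec u u

theorem householder_transpose (u : Fin m → ℝ) : (householder u)ᵀ = householder u := by
  simp [householder, transpose_vecMulVec]

theorem householder_mem_stiefel (u : Fin m → ℝ) : householder u ∈ stiefel m m := by
  simp only [mem_stiefel_iff, householder_transpose]
  have h : vecMulVec u u * vecMulVec u u = (u ⬝ᵥ u) • vecMulVec u u := by
    rw [vecMulVec_mul_vecMulVec, vecMulVec_smul]
  by_cases hu : u ⬝ᵥ u = 0
  · simp [householder, hu]
  · simp only [householder, Matrix.sub_mul, Matrix.mul_sub, Matrix.one_mul, Matrix.mul_one,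
      Matrix.smul_mul, Matrix.mul_smul, h, smul_smul]
    rw [div_mul_cancel₀ _ hu]
    module

theorem trace_householder_mul (u : Fin m → ℝ) (N : Matrix (Fin m) (Fin m) ℝ) :
    (householder u * N).trace = N.trace - 2 / (u ⬝ᵥ u) * (u ⬝ᵥ N *ᵥ u) := by
  rw [householder, Matrix.sub_mul, trace_sub, Matrix.one_mul, Matrix.smul_mul, trace_smul,
    vecMulVec_mul, trace_vecMulVec, smul_eq_mul, dotProduct_mulVec, dotProduct_comm (u ᵥ* N)]

/-- A matrix that is trace-orthogonal to all skew-symmetric matrices is symmetric. -/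
theorem isSymm_of_trace_skew_eq_zero {N : Matrix (Fin m) (Fin m) ℝ}
    (h : ∀ A : Matrix (Fin m) (Fin m) ℝ, Aᵀ = -A → (Aᵀ * N).trace = 0) : N.IsSymm := by
  have hA : (N - Nᵀ)ᵀ = -(N - Nᵀ) := by simp
  have h1 := h _ hA
  have h2 : ((N - Nᵀ)ᵀ * Nᵀ).trace = 0 := by
    rw [← transpose_mul, trace_transpose, trace_mul_comm]
    rw [hA, Matrix.neg_mul, trace_neg] at h1
    linarith
  have h3 : ((N - Nᵀ)ᴴ * (N - Nᵀ)).trace = 0 := by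
    rw [conjTranspose_eq_transpose_of_trivial, Matrix.mul_sub, trace_sub, h1, h2, sub_zero]
  exact (sub_eq_zero.1 (trace_conjTranspose_mul_self_eq_zero_iff.1 h3)).symm

theorem trace_skew_mul_isSymm {A S : Matrix (Fin m) (Fin m) ℝ} (hA : Aᵀ = -A) (hS : S.IsSymm) :
    (A * S).trace = 0 := by
  have h := trace_transpose (A * S)
  rw [transpose_mul, hA, hS.eq, Matrix.mul_neg, trace_neg, trace_mul_comm] at h
  linarith

/-- If the identity maximizes `R ↦ tr(Rᵀ N)` over the orthogonal matrices, then `N` is positive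
semidefinite. -/
theorem posSemidef_of_forall_trace_le {N : Matrix (Fin m) (Fin m) ℝ}
    (h : ∀ R ∈ stiefel m m, (Rᵀ * N).trace ≤ N.trace) : N.PosSemidef := by
  -- Stationarity of the trace along the rotations exp(tA), for every skew A.
  have hsymm : N.IsSymm := by
    refine isSymm_of_trace_skew_eq_zero fun A hA => ?_
    have hd : HasDerivAt (fun t : ℝ => ((NormedSpace.exp (t • A))ᵀ * N).trace)
        (Aᵀ * N).trace 0 := by
      have := ((hasDerivAt_matrix_exp A 0).matrix_transpose'.matrix_mul'
        (hasDerivAt_const (0 : ℝ) N)).matrix_trace'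
      simpa using this
    have hmax : IsLocalMax (fun t : ℝ => ((NormedSpace.exp (t • A))ᵀ * N).trace) 0 := by
      refine Filter.Eventually.of_forall fun t => ?_
      simpa using h _ (exp_smul_mem_stiefel hA t)
    exact hmax.hasDerivAt_eq_zero hd
  refine PosSemidef.of_dotProduct_mulVec_nonneg
    (by rw [IsHermitian, conjTranspose_eq_transpose_of_trivial]; exact hsymm) fun u => ?_
  -- Reflecting along u lowers the trace by 2 uᵀNu / uᵀu, so maximality gives uᵀNu ≥ 0.
  have h1 := h _ (householder_mem_stiefel u)
  rw [householder_transpose, trace_householder_mul] at h1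
  rw [star_trivial]
  by_cases hu : u ⬝ᵥ u = 0
  · rw [dotProduct_self_eq_zero.1 hu]; simp
  · have hpos : 0 < u ⬝ᵥ u := lt_of_le_of_ne (Finset.sum_nonneg fun i _ => mul_self_nonneg (u i)) (Ne.symm hu)
    have : 0 ≤ 2 / (u ⬝ᵥ u) * (u ⬝ᵥ N *ᵥ u) := by linarith
    exact nonneg_of_mul_nonneg_right this (by positivity)

theorem isCompact_stiefel (n k : ℕ) : IsCompact (stiefel n k) := by
  have hc : IsClosed (stiefel n k) := by
    have : Continuous fun X : Matrix (Fin n) (Fin k) ℝ => Xᵀ * X :=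
      continuous_id.matrix_transpose.matrix_mul continuous_id
    exact isClosed_singleton.preimage this
  refine Metric.isCompact_of_isClosed_isBounded hc ?_
  refine (Metric.isBounded_closedBall (x := (0 : Matrix (Fin n) (Fin k) ℝ)) (r := 1)).subset ?_
  intro X hX
  rw [mem_closedBall_zero_iff, Matrix.norm_le_iff zero_le_one]
  intro i j
  have h : ∑ l, X l j * X l j = 1 := by
    have := congrFun (congrFun (show Xᵀ * X = 1 from hX) j) j
    simpa [Matrix.mul_apply] using this
  have h2 : X i j * X i j ≤ 1 := by
    rw [← h]
    exact Finset.single_le_sum (f := fun l => X l j * X l j)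
      (fun l _ => mul_self_nonneg _) (Finset.mem_univ i)
  rw [Real.norm_eq_abs]
  exact abs_le_one_iff_mul_self_le_one.2 h2

/-- The positive semidefinite square root. -/
noncomputable def psdSqrt (m : ℕ) : Matrix (Fin m) (Fin m) ℝ → Matrix (Fin m) (Fin m) ℝ :=
  (exists_continuous_posSemidef_sqrt m).choose

theorem psdSqrt_posSemidef {A : Matrix (Fin m) (Fin m) ℝ} (hA : A.PosSemidef) :
    (psdSqrt m A).PosSemidef :=
  ((exists_continuous_posSemidef_sqrt m).choose_spec.2.1 A hA).1

theorem psdSqrt_mul_self {A : Matrix (Fin m) (Fin m) ℝ} (hA : A.PosSemidef) :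
    psdSqrt m A * psdSqrt m A = A :=
  ((exists_continuous_posSemidef_sqrt m).choose_spec.2.1 A hA).2

theorem psdSqrt_of_mul_self {B : Matrix (Fin m) (Fin m) ℝ} (hB : B.PosSemidef) :
    psdSqrt m (B * B) = B :=
  (exists_continuous_posSemidef_sqrt m).choose_spec.2.2 B hB

/-- The orthogonal projection onto the kernel of a matrix. -/
theorem exists_kernel_projection (D : Matrix (Fin n) (Fin k) ℝ) :
    ∃ K : Matrix (Fin k) (Fin k) ℝ, K.PosSemidef ∧ K * K = K ∧ D * K = 0 ∧
      ∀ x, D *ᵥ x = 0 → K *ᵥ x = 0 → x = 0 := by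
  have hA := (posSemidef_conjTranspose_mul_self D).isHermitian
  set U : Matrix (Fin k) (Fin k) ℝ := (hA.eigenvectorUnitary).1 with hU
  set l := hA.eigenvalues with hl
  -- Indicator of the zero eigenvalues of DᵀD, whose eigenvectors span ker D.
  set d : Fin k → ℝ := fun i => if l i = 0 then 1 else 0 with hd
  have hUU : Uᴴ * U = 1 := Unitary.coe_star_mul_self hA.eigenvectorUnitary
  have hUU' : U * Uᴴ = 1 := Unitary.coe_mul_star_self hA.eigenvectorUnitary
  have hspec : Dᴴ * D = U * diagonal l * Uᴴ := by
    have := hA.spectral_theorem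
    rw [Unitary.conjStarAlgAut_apply] at this
    exact this
  refine ⟨U * diagonal d * Uᴴ, ?_, ?_, ?_, ?_⟩
  · refine PosSemidef.mul_mul_conjTranspose_same (PosSemidef.diagonal fun i => ?_) U
    simp only [hd, Pi.zero_apply]; split_ifs <;> norm_num
  · have : diagonal d * diagonal d = diagonal d := by
      rw [diagonal_mul_diagonal]
      congr 1; funext i; simp [hd]
    calc U * diagonal d * Uᴴ * (U * diagonal d * Uᴴ)
        = U * diagonal d * (Uᴴ * U) * diagonal d * Uᴴ := by simp only [Matrix.mul_assoc]
      _ = _ := by rw [hUU, Matrix.mul_one, Matrix.mul_assoc U, this]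
  · have h0 : Dᴴ * D * (U * diagonal d * Uᴴ) = 0 := by
      have : diagonal l * diagonal d = 0 := by
        rw [diagonal_mul_diagonal, ← diagonal_zero]
        congr 1; funext i; simp [hd]
      calc Dᴴ * D * (U * diagonal d * Uᴴ)
          = U * diagonal l * (Uᴴ * U) * diagonal d * Uᴴ := by
            rw [hspec]; simp only [Matrix.mul_assoc]
        _ = 0 := by rw [hUU, Matrix.mul_one, Matrix.mul_assoc U, this]; simp
    exact (conjTranspose_mul_self_mul_eq_zero _ _).1 h0
  · intro x hx hKx
    have h1 : diagonal l *ᵥ (Uᴴ *ᵥ x) = 0 := by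
      have : Uᴴ *ᵥ ((Dᴴ * D) *ᵥ x) = 0 := by rw [← mulVec_mulVec, hx]; simp
      rw [hspec, mulVec_mulVec, Matrix.mul_assoc, ← Matrix.mul_assoc, hUU, Matrix.one_mul] at this
      rw [mulVec_mulVec, this]
    have h2 : diagonal d *ᵥ (Uᴴ *ᵥ x) = 0 := by
      have : Uᴴ *ᵥ ((U * diagonal d * Uᴴ) *ᵥ x) = 0 := by rw [hKx]; simp
      rw [mulVec_mulVec, Matrix.mul_assoc, ← Matrix.mul_assoc, hUU, Matrix.one_mul] at this
      rw [mulVec_mulVec, this]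
    have h3 : Uᴴ *ᵥ x = 0 := by
      funext i
      have e1 := congrFun h1 i
      have e2 := congrFun h2 i
      rw [mulVec_diagonal] at e1 e2
      by_cases hi : l i = 0
      · simpa [hd, hi] using e2
      · simpa [hi] using e1
    calc x = (U * Uᴴ) *ᵥ x := by rw [hUU', one_mulVec]
      _ = 0 := by rw [← mulVec_mulVec, h3, mulVec_zero]

end Stiefel

/-! ### Gradients of invariant functions and existence of coefficient functions. -/

section Gradient

variable {n k : ℕ}

theorem fderiv_apply_eq_trace (φ : Matrix (Fin n) (Fin k) ℝ → ℝ)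
    (X V : Matrix (Fin n) (Fin k) ℝ) :
    fderiv ℝ φ X V = (Vᵀ * matrixGradient φ X).trace := by
  conv_lhs => rw [matrix_eq_sum_single V]
  simp only [map_sum, trace, diag_apply, mul_apply, transpose_apply, matrixGradient, of_apply]
  rw [Finset.sum_comm]
  refine Finset.sum_congr rfl fun j _ => Finset.sum_congr rfl fun i _ => ?_
  rw [← smul_eq_mul, ← map_smul, smul_single, smul_eq_mul, mul_one]

theorem continuousAt_linearMap_fderiv {E F : Type*} [NormedAddCommGroup E] [NormedSpace ℝ E]
    [FiniteDimensional ℝ E] [NormedAddCommGroup F] [NormedSpace ℝ F] {φ : E → ℝ} {x : E}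
    (L : (E →ₗ[ℝ] ℝ) →ₗ[ℝ] F) (h : ContDiffAt ℝ 1 φ x) :
    ContinuousAt (fun y => L (fderiv ℝ φ y).toLinearMap) x := by
  let L' : (E →L[ℝ] ℝ) →L[ℝ] F :=
    (L ∘ₗ ContinuousLinearMap.coeLM ℝ).toContinuousLinearMap
  exact L'.continuous.continuousAt.comp (h.continuousAt_fderiv one_ne_zero)

theorem differentiableAt_linearMap_fderiv {E F : Type*} [NormedAddCommGroup E]
    [NormedSpace ℝ E] [FiniteDimensional ℝ E] [NormedAddCommGroup F] [NormedSpace ℝ F]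
    {φ : E → ℝ} {x : E} (L : (E →ₗ[ℝ] ℝ) →ₗ[ℝ] F) (h : DifferentiableAt ℝ (fderiv ℝ φ) x) :
    DifferentiableAt ℝ (fun y => L (fderiv ℝ φ y).toLinearMap) x := by
  let L' : (E →L[ℝ] ℝ) →L[ℝ] F :=
    (L ∘ₗ ContinuousLinearMap.coeLM ℝ).toContinuousLinearMap
  exact L'.differentiableAt.comp x h

/-- The linear map that represents a functional by a matrix with respect to the trace pairing. -/
def matrixOfFunctional (n k : ℕ) :
    (Matrix (Fin n) (Fin k) ℝ →ₗ[ℝ] ℝ) →ₗ[ℝ] Matrix (Fin n) (Fin k) ℝ where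
  toFun f := Matrix.of fun i j => f (Matrix.single i j 1)
  map_add' f g := by ext i j; simp
  map_smul' c f := by ext i j; simp

theorem continuousAt_matrixGradient {φ : Matrix (Fin n) (Fin k) ℝ → ℝ}
    {X : Matrix (Fin n) (Fin k) ℝ} (h : ContDiffAt ℝ 1 φ X) :
    ContinuousAt (matrixGradient φ) X :=
  continuousAt_linearMap_fderiv (matrixOfFunctional n k) h

theorem differentiableAt_matrixGradient {φ : Matrix (Fin n) (Fin k) ℝ → ℝ}
    {X : Matrix (Fin n) (Fin k) ℝ} (h : DifferentiableAt ℝ (fderiv ℝ φ) X) :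
    DifferentiableAt ℝ (matrixGradient φ) X :=
  differentiableAt_linearMap_fderiv (matrixOfFunctional n k) h

/-- Right multiplication by an orthogonal matrix. -/
noncomputable def mulRightStiefel {Q : Matrix (Fin k) (Fin k) ℝ} (hQ : Q ∈ stiefel k k) :
    Matrix (Fin n) (Fin k) ℝ ≃L[ℝ] Matrix (Fin n) (Fin k) ℝ :=
  LinearEquiv.toContinuousLinearEquiv
    { toFun := fun X => X * Q
      map_add' := fun X Y => Matrix.add_mul X Y Q
      map_smul' := fun c X => Matrix.smul_mul c X Q
      invFun := fun X => X * Qᵀ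
      left_inv := fun X => by
        change X * Q * Qᵀ = X
        rw [Matrix.mul_assoc, mul_transpose_of_mem_stiefel hQ, Matrix.mul_one]
      right_inv := fun X => by
        change X * Qᵀ * Q = X
        rw [Matrix.mul_assoc, mem_stiefel_iff.1 hQ, Matrix.mul_one] }

theorem RightUnitarilyInvariant.fderiv_mul {φ : Matrix (Fin n) (Fin k) ℝ → ℝ}
    (hφ : RightUnitarilyInvariant φ) {Q : Matrix (Fin k) (Fin k) ℝ} (hQ : Q ∈ stiefel k k)
    (X V : Matrix (Fin n) (Fin k) ℝ) : fderiv ℝ φ (X * Q) (V * Q) = fderiv ℝ φ X V := by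
  have h := (mulRightStiefel (n := n) hQ).comp_right_fderiv (f := φ) (x := X)
  have h1 : φ ∘ mulRightStiefel hQ = φ := funext fun Y => hφ Y Q hQ
  have h2 := congrArg (fun f => f V) h
  exact h2.symm.trans (congrArg (fun f => fderiv ℝ f X V) h1)

theorem RightUnitarilyInvariant.matrixGradient_mul {φ : Matrix (Fin n) (Fin k) ℝ → ℝ}
    (hφ : RightUnitarilyInvariant φ) {Q : Matrix (Fin k) (Fin k) ℝ} (hQ : Q ∈ stiefel k k)
    (X : Matrix (Fin n) (Fin k) ℝ) : matrixGradient φ (X * Q) = matrixGradient φ X * Q := by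
  rw [Matrix.ext_iff_trace_mul_left]
  intro V
  have h := hφ.fderiv_mul hQ X (Vᵀ * Qᵀ)
  rw [Matrix.mul_assoc, mem_stiefel_iff.1 hQ, Matrix.mul_one, fderiv_apply_eq_trace,
    fderiv_apply_eq_trace, transpose_transpose, transpose_mul, transpose_transpose,
    transpose_transpose, Matrix.mul_assoc] at h
  rw [h, trace_mul_comm, Matrix.mul_assoc]

/-- φ is constant along X exp(tA) for skew A, so its gradient is orthogonal to every XA. -/
theorem RightUnitarilyInvariant.isSymm_transpose_mul_matrixGradient
    {φ : Matrix (Fin n) (Fin k) ℝ → ℝ} (hφ : RightUnitarilyInvariant φ)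
    {X : Matrix (Fin n) (Fin k) ℝ} (hX : DifferentiableAt ℝ φ X) :
    (Xᵀ * matrixGradient φ X).IsSymm := by
  refine isSymm_of_trace_skew_eq_zero fun A hA => ?_
  have hd : HasDerivAt (fun t : ℝ => X * NormedSpace.exp (t • A)) (X * A) 0 := by
    have := (hasDerivAt_const (0 : ℝ) X).matrix_mul' (hasDerivAt_matrix_exp A 0)
    simpa using this
  have h0 : (fun t : ℝ => X * NormedSpace.exp (t • A)) 0 = X := by simp
  have h1 : HasDerivAt (fun t : ℝ => φ (X * NormedSpace.exp (t • A)))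
      (fderiv ℝ φ X (X * A)) 0 := by
    have h2 : HasFDerivAt φ (fderiv ℝ φ X) ((fun t : ℝ => X * NormedSpace.exp (t • A)) 0) := by
      rw [h0]; exact hX.hasFDerivAt
    exact h2.comp_hasDerivAt (0 : ℝ) hd
  have h2 : (fun t : ℝ => φ (X * NormedSpace.exp (t • A))) = fun _ => φ X :=
    funext fun t => hφ X _ (exp_smul_mem_stiefel hA t)
  rw [h2] at h1
  have h3 := h1.unique (hasDerivAt_const (0 : ℝ) (φ X))
  rwa [fderiv_apply_eq_trace, transpose_mul, Matrix.mul_assoc] at h3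

/-- A canonical admissible coefficient function. -/
noncomputable def gradientFactor (φ : Matrix (Fin n) (Fin k) ℝ → ℝ)
    (X : Matrix (Fin n) (Fin k) ℝ) : Matrix (Fin n) (Fin n) ℝ :=
  matrixGradient φ X * Xᵀ + X * (matrixGradient φ X)ᵀ -
    (1 / 2 : ℝ) • (X * (Xᵀ * matrixGradient φ X + (matrixGradient φ X)ᵀ * X) * Xᵀ)

theorem gradientFactor_isSymm (φ : Matrix (Fin n) (Fin k) ℝ → ℝ)
    (X : Matrix (Fin n) (Fin k) ℝ) : (gradientFactor φ X).IsSymm := by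
  simp only [IsSymm, gradientFactor, transpose_sub, transpose_add, transpose_mul,
    transpose_transpose, transpose_smul, Matrix.mul_assoc]
  rw [add_comm (X * (matrixGradient φ X)ᵀ), add_comm ((matrixGradient φ X)ᵀ * X)]

theorem RightUnitarilyInvariant.gradientFactor {φ : Matrix (Fin n) (Fin k) ℝ → ℝ}
    (hφ : RightUnitarilyInvariant φ) : RightUnitarilyInvariant (gradientFactor φ) := by
  intro X Q hQ
  have hQ' (Y : Matrix (Fin k) (Fin n) ℝ) : Q * (Qᵀ * Y) = Y := by
    rw [← Matrix.mul_assoc, mul_transpose_of_mem_stiefel hQ, Matrix.one_mul]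
  simp only [_root_.gradientFactor, hφ.matrixGradient_mul hQ, transpose_mul, Matrix.mul_assoc,
    Matrix.mul_add, Matrix.add_mul, hQ']

theorem isGradientFactor_gradientFactor {φ : Matrix (Fin n) (Fin k) ℝ → ℝ}
    (hφ : RightUnitarilyInvariant φ) (hC : ∀ X ∈ stiefel n k, ContDiffAt ℝ 1 φ X) :
    IsGradientFactor φ (gradientFactor φ) where
  isSymm := gradientFactor_isSymm φ
  invariant := hφ.gradientFactor
  continuousAt X hX := by
    have hg := continuousAt_matrixGradient (hC X hX)
    have hT {a b : ℕ} (M : Matrix (Fin a) (Fin b) ℝ) :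
        ContinuousAt (fun Y : Matrix (Fin a) (Fin b) ℝ => Yᵀ) M :=
      continuous_id.matrix_transpose.continuousAt
    have hgT : ContinuousAt (fun Y => (matrixGradient φ Y)ᵀ) X := (hT _).comp hg
    have hid : ContinuousAt (fun Y : Matrix (Fin n) (Fin k) ℝ => Y) X := continuousAt_id
    exact ((hg.matrix_mul' (hT X)).add (hid.matrix_mul' hgT)).sub
      (((hid.matrix_mul' (((hT X).matrix_mul' hg).add (hgT.matrix_mul' hid))).matrix_mul'
        (hT X)).const_smul (1 / 2 : ℝ))
  gradient_eq X hX := by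
    have hs : (matrixGradient φ X)ᵀ * X = Xᵀ * matrixGradient φ X := by
      have := (hφ.isSymm_transpose_mul_matrixGradient
        ((hC X hX).differentiableAt one_ne_zero)).eq
      rwa [transpose_mul, transpose_transpose] at this
    have hX1 : Xᵀ * X = 1 := hX
    -- With g the gradient and S = Xᵀg symmetric, applying the factor to X gives g + XS - ½ X(2S) =
    -- g.
    rw [gradientFactor, hs, ← two_smul ℝ (Xᵀ * _), Matrix.mul_smul, Matrix.smul_mul, smul_smul,
      Matrix.sub_mul, Matrix.add_mul]
    simp only [Matrix.mul_assoc, hX1, hs, Matrix.smul_mul, Matrix.mul_one]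
    norm_num

theorem differentiableAt_gradientFactor {φ : Matrix (Fin n) (Fin k) ℝ → ℝ}
    {X : Matrix (Fin n) (Fin k) ℝ} (h : DifferentiableAt ℝ (fderiv ℝ φ) X) :
    DifferentiableAt ℝ (gradientFactor φ) X := by
  have hg := differentiableAt_matrixGradient h
  have hid : DifferentiableAt ℝ (fun Y : Matrix (Fin n) (Fin k) ℝ => Y) X := differentiableAt_id
  exact ((hg.matrix_mul' hid.matrix_transpose').add (hid.matrix_mul' hg.matrix_transpose')).sub
    (((hid.matrix_mul' ((hid.matrix_transpose'.matrix_mul' hg).add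
      (hg.matrix_transpose'.matrix_mul' hid))).matrix_mul' hid.matrix_transpose').const_smul (1 / 2 : ℝ))

end Gradient

/-! ### First-order optimality and the kernel of XᵀD. -/

section Maximizer

variable {n k : ℕ}

theorem exp_smul_mul_mem_stiefel {A : Matrix (Fin n) (Fin n) ℝ} (hA : Aᵀ = -A)
    {X : Matrix (Fin n) (Fin k) ℝ} (hX : X ∈ stiefel n k) (t : ℝ) :
    NormedSpace.exp (t • A) * X ∈ stiefel n k :=
  mul_mem_stiefel (exp_smul_mem_stiefel hA t) hX

theorem hasDerivAt_exp_smul_mul (A : Matrix (Fin n) (Fin n) ℝ) (X : Matrix (Fin n) (Fin k) ℝ)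
    (t : ℝ) : HasDerivAt (fun t : ℝ => NormedSpace.exp (t • A) * X)
      (A * (NormedSpace.exp (t • A) * X)) t := by
  have := (hasDerivAt_matrix_exp A t).matrix_mul' (hasDerivAt_const t X)
  simpa [Matrix.mul_assoc] using this

theorem transpose_sub_transpose_skew (V X : Matrix (Fin n) (Fin k) ℝ) :
    (V * Xᵀ - X * Vᵀ)ᵀ = -(V * Xᵀ - X * Vᵀ) := by
  simp

theorem skew_mul_of_mem_stiefel {V X : Matrix (Fin n) (Fin k) ℝ} (hX : X ∈ stiefel n k)
    (hV : Xᵀ * V = 0) : (V * Xᵀ - X * Vᵀ) * X = V := by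
  have h : Vᵀ * X = 0 := by
    rw [← transpose_transpose X, ← transpose_mul, hV, transpose_zero]
  rw [Matrix.sub_mul, Matrix.mul_assoc, Matrix.mul_assoc, mem_stiefel_iff.1 hX, h,
    Matrix.mul_one, Matrix.mul_zero, sub_zero]

theorem objective_mul {φ ψ : Matrix (Fin n) (Fin k) ℝ → ℝ} (hφ : RightUnitarilyInvariant φ)
    (hψ : RightUnitarilyInvariant ψ) (D X : Matrix (Fin n) (Fin k) ℝ)
    {Q : Matrix (Fin k) (Fin k) ℝ} (hQ : Q ∈ stiefel k k) :
    objective φ ψ D (X * Q) = φ X + ψ X * ((X * Q)ᵀ * D).trace := by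
  rw [objective, hφ X Q hQ, hψ X Q hQ]

/-- First-order optimality, tested at all maximizers `X Q` in the orbit of `X`. -/
theorem first_order_condition {φ ψ : Matrix (Fin n) (Fin k) ℝ → ℝ}
    {D X V : Matrix (Fin n) (Fin k) ℝ} {Q : Matrix (Fin k) (Fin k) ℝ}
    (hφ : RightUnitarilyInvariant φ) (hψ : RightUnitarilyInvariant ψ)
    (hφd : DifferentiableAt ℝ φ X) (hψd : DifferentiableAt ℝ ψ X)
    (hX : X ∈ stiefel n k) (hmax : IsMaxOn (objective φ ψ D) (stiefel n k) X)
    (hV : Xᵀ * V = 0) (hQ : Q ∈ stiefel k k)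
    (hQD : ((X * Q)ᵀ * D).trace = (Xᵀ * D).trace) :
    (Vᵀ * matrixGradient φ X).trace + (Xᵀ * D).trace * (Vᵀ * matrixGradient ψ X).trace +
      ψ X * ((V * Q)ᵀ * D).trace = 0 := by
  -- A is skew with AX = V, so exp(tA)X stays on the manifold and leaves X with velocity V.
  set A := V * Xᵀ - X * Vᵀ with hA
  have hskew : Aᵀ = -A := transpose_sub_transpose_skew V X
  have hγ := hasDerivAt_exp_smul_mul A X 0
  set γ : ℝ → Matrix (Fin n) (Fin k) ℝ := fun t => NormedSpace.exp (t • A) * X with hγd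
  have h0 : γ 0 = X := by simp [hγd]
  change HasDerivAt γ (A * γ 0) 0 at hγ
  rw [h0, skew_mul_of_mem_stiefel hX hV] at hγ
  have hd {χ : Matrix (Fin n) (Fin k) ℝ → ℝ} (hχ : DifferentiableAt ℝ χ X) :
      HasDerivAt (fun t => χ (γ t)) (Vᵀ * matrixGradient χ X).trace 0 := by
    have h2 : HasFDerivAt χ (fderiv ℝ χ X) (γ 0) := by rw [h0]; exact hχ.hasFDerivAt
    rw [← fderiv_apply_eq_trace]
    exact h2.comp_hasDerivAt (0 : ℝ) hγ
  have htr : HasDerivAt (fun t => ((γ t * Q)ᵀ * D).trace) ((V * Q)ᵀ * D).trace 0 := by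
    have := ((hγ.matrix_mul' (hasDerivAt_const (0 : ℝ) Q)).matrix_transpose'.matrix_mul'
      (hasDerivAt_const (0 : ℝ) D)).matrix_trace'
    simpa using this
  have hder := (hd hφd).add ((hd hψd).mul htr)
  have hloc : IsLocalMax (fun t => φ (γ t) + ψ (γ t) * ((γ t * Q)ᵀ * D).trace) 0 := by
    refine Filter.Eventually.of_forall fun t => ?_
    have h1 := hmax (mul_mem_stiefel (exp_smul_mul_mem_stiefel hskew hX t) hQ)
    have h2 : objective φ ψ D (γ t * Q) ≤ objective φ ψ D X := h1
    rw [objective_mul hφ hψ D (γ t) hQ] at h2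
    simp only [h0, hQD]
    exact h2
  have h3 := hloc.hasDerivAt_eq_zero hder
  rw [h0, hQD] at h3
  linarith

/-- At a maximizer `X` the kernel of `Xᵀ D` is that of `D`. -/
theorem mulVec_eq_zero_of_maximizer {φ ψ : Matrix (Fin n) (Fin k) ℝ → ℝ}
    {D X : Matrix (Fin n) (Fin k) ℝ}
    (hφ : RightUnitarilyInvariant φ) (hψ : RightUnitarilyInvariant ψ)
    (hφd : DifferentiableAt ℝ φ X) (hψd : DifferentiableAt ℝ ψ X) (hpos : 0 < ψ X)
    (hX : X ∈ stiefel n k) (hmax : IsMaxOn (objective φ ψ D) (stiefel n k) X)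
    {u : Fin k → ℝ} (hu : (Xᵀ * D) *ᵥ u = 0) : D *ᵥ u = 0 := by
  by_cases hu0 : u ⬝ᵥ u = 0
  · rw [dotProduct_self_eq_zero.1 hu0, mulVec_zero]
  -- V = (Du)uᵀ is admissible since XᵀDu = 0. The reflection along u also preserves tr(XᵀD), so
  -- stationarity may be tested at both orbit points; the two conditions differ by 2ψ(X)‖Du‖².
  set V := vecMulVec (D *ᵥ u) u with hVdef
  have hV : Xᵀ * V = 0 := by
    rw [hVdef, mul_vecMulVec, mulVec_mulVec, hu, zero_vecMulVec]
  have h1 := first_order_condition hφ hψ hφd hψd hX hmax hV one_mem_stiefel (by simp)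
  have h2 := first_order_condition hφ hψ hφd hψd hX hmax hV (householder_mem_stiefel u)
    (by rw [transpose_mul, householder_transpose, Matrix.mul_assoc, trace_householder_mul, hu]
        simp)
  have hw : (Vᵀ * D) *ᵥ u = (D *ᵥ u ⬝ᵥ D *ᵥ u) • u := by
    rw [← mulVec_mulVec, hVdef, transpose_vecMulVec, vecMulVec_mulVec, op_smul_eq_smul]
  rw [transpose_mul, householder_transpose, Matrix.mul_assoc, trace_householder_mul, hw,
    dotProduct_smul, smul_eq_mul, mul_comm (D *ᵥ u ⬝ᵥ D *ᵥ u), ← mul_assoc,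
    div_mul_cancel₀ _ hu0] at h2
  rw [Matrix.mul_one] at h1
  have h3 : ψ X * (D *ᵥ u ⬝ᵥ D *ᵥ u) = 0 := by linarith
  exact dotProduct_self_eq_zero.1 ((mul_eq_zero.1 h3).resolve_left hpos.ne')

theorem rank_mul_eq_of_mulVec_eq_zero {a b c : ℕ} {A : Matrix (Fin a) (Fin b) ℝ}
    {B : Matrix (Fin b) (Fin c) ℝ} (h : ∀ u, (A * B) *ᵥ u = 0 → B *ᵥ u = 0) :
    (A * B).rank = B.rank := by
  have hker : LinearMap.ker (A * B).mulVecLin = LinearMap.ker B.mulVecLin := by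
    ext u
    simp only [LinearMap.mem_ker, mulVecLin_apply]
    exact ⟨h u, fun hu => by rw [← mulVec_mulVec, hu, mulVec_zero]⟩
  have h1 := LinearMap.finrank_range_add_finrank_ker (A * B).mulVecLin
  have h2 := LinearMap.finrank_range_add_finrank_ker B.mulVecLin
  rw [hker] at h1
  simp only [Matrix.rank]
  omega

end Maximizer

/-! ### Aligned points and the invertible root P. -/

section Alignment

variable {n k : ℕ}

theorem alignments_nonempty {φ ψ : Matrix (Fin n) (Fin k) ℝ → ℝ}
    (hφ : RightUnitarilyInvariant φ) (hψ : RightUnitarilyInvariant ψ)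
    (D X : Matrix (Fin n) (Fin k) ℝ) : (alignments (objective φ ψ D) X).Nonempty := by
  have hc : Continuous fun Q : Matrix (Fin k) (Fin k) ℝ =>
      φ X + ψ X * ((X * Q)ᵀ * D).trace :=
    continuous_const.add (continuous_const.mul
      ((continuous_const.matrix_mul continuous_id).matrix_transpose.matrix_mul
        continuous_const).matrix_trace)
  obtain ⟨Q, hQ, hQm⟩ := (isCompact_stiefel k k).exists_isMaxOn ⟨1, one_mem_stiefel⟩
    hc.continuousOn
  refine ⟨X * Q, Q, hQ, fun R hR => ?_, rfl⟩
  have h : φ X + ψ X * ((X * R)ᵀ * D).trace ≤ φ X + ψ X * ((X * Q)ᵀ * D).trace := hQm hR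
  rw [← objective_mul hφ hψ D X hR, ← objective_mul hφ hψ D X hQ] at h
  exact h

theorem self_mem_alignments {f : Matrix (Fin n) (Fin k) ℝ → ℝ} {X : Matrix (Fin n) (Fin k) ℝ}
    (hX : X ∈ stiefel n k) (hmax : IsMaxOn f (stiefel n k) X) : X ∈ alignments f X :=
  ⟨1, one_mem_stiefel, fun R hR => by simpa using hmax (mul_mem_stiefel hX hR),
    (Matrix.mul_one X).symm⟩

/-- φ and ψ are constant on the orbit and ψ(X) > 0, so an alignment maximizes the trace term alone.
X need not have orthonormal columns. -/
theorem posSemidef_of_mem_alignments {φ ψ : Matrix (Fin n) (Fin k) ℝ → ℝ}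
    (hφ : RightUnitarilyInvariant φ) (hψ : RightUnitarilyInvariant ψ)
    {D X Y : Matrix (Fin n) (Fin k) ℝ} (hX : 0 < ψ X)
    (hY : Y ∈ alignments (objective φ ψ D) X) :
    ∃ Q ∈ stiefel k k, Y = X * Q ∧ (Yᵀ * D).PosSemidef := by
  obtain ⟨Q, hQ, hm, rfl⟩ := hY
  refine ⟨Q, hQ, rfl, posSemidef_of_forall_trace_le fun R hR => ?_⟩
  have h : objective φ ψ D (X * (Q * R)) ≤ objective φ ψ D (X * Q) :=
    hm (mul_mem_stiefel hQ hR)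
  rw [objective_mul hφ hψ D X hQ, objective_mul hφ hψ D X (mul_mem_stiefel hQ hR)] at h
  have h2 := le_of_mul_le_mul_left (le_of_add_le_add_left h) hX
  rwa [← Matrix.mul_assoc, transpose_mul, Matrix.mul_assoc] at h2

/-- The square root of `(Xᵀ D)ᵀ (Xᵀ D) + K`. -/
noncomputable def alignedRoot (D : Matrix (Fin n) (Fin k) ℝ) (K : Matrix (Fin k) (Fin k) ℝ)
    (X : Matrix (Fin n) (Fin k) ℝ) : Matrix (Fin k) (Fin k) ℝ :=
  psdSqrt k ((Xᵀ * D)ᵀ * (Xᵀ * D) + K)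

/-- The symmetric matrix `D P⁻¹ Dᵀ`, where `P` is the aligned root at `X`. -/
noncomputable def alignedKernel (D : Matrix (Fin n) (Fin k) ℝ) (K : Matrix (Fin k) (Fin k) ℝ)
    (X : Matrix (Fin n) (Fin k) ℝ) : Matrix (Fin n) (Fin n) ℝ :=
  D * (alignedRoot D K X)⁻¹ * Dᵀ

variable {D : Matrix (Fin n) (Fin k) ℝ} {K : Matrix (Fin k) (Fin k) ℝ}

theorem posSemidef_transpose_mul_self_add (hK : K.PosSemidef) (M : Matrix (Fin k) (Fin k) ℝ) :
    (Mᵀ * M + K).PosSemidef := by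
  have := (posSemidef_conjTranspose_mul_self M).add hK
  rwa [conjTranspose_eq_transpose_of_trivial] at this

theorem alignedRoot_posSemidef (hK : K.PosSemidef) (X : Matrix (Fin n) (Fin k) ℝ) :
    (alignedRoot D K X).PosSemidef :=
  psdSqrt_posSemidef (posSemidef_transpose_mul_self_add hK _)

theorem alignedRoot_mul_self (hK : K.PosSemidef) (X : Matrix (Fin n) (Fin k) ℝ) :
    alignedRoot D K X * alignedRoot D K X = (Xᵀ * D)ᵀ * (Xᵀ * D) + K :=
  psdSqrt_mul_self (posSemidef_transpose_mul_self_add hK _)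

theorem alignedKernel_isSymm (hK : K.PosSemidef) (X : Matrix (Fin n) (Fin k) ℝ) :
    (alignedKernel D K X).IsSymm := by
  have h : (alignedRoot D K X)ᵀ = alignedRoot D K X := by
    have := (alignedRoot_posSemidef (D := D) hK X).isHermitian.eq
    rwa [conjTranspose_eq_transpose_of_trivial] at this
  rw [IsSymm, alignedKernel, transpose_mul, transpose_mul, transpose_transpose,
    transpose_nonsing_inv, h, Matrix.mul_assoc]

/-- The determinant makes positive definiteness of the root an open condition in X. -/
theorem alignedRoot_posDef_iff (hK : K.PosSemidef) (X : Matrix (Fin n) (Fin k) ℝ) :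
    (alignedRoot D K X).PosDef ↔ ((Xᵀ * D)ᵀ * (Xᵀ * D) + K).det ≠ 0 := by
  rw [(alignedRoot_posSemidef hK X).posDef_iff_det_ne_zero, ← alignedRoot_mul_self hK X, det_mul]
  simp

theorem alignedRoot_posDef_of_ker (hK : K.PosSemidef)
    (hDK : ∀ x, D *ᵥ x = 0 → K *ᵥ x = 0 → x = 0) {X : Matrix (Fin n) (Fin k) ℝ}
    (hX : ∀ u, (Xᵀ * D) *ᵥ u = 0 → D *ᵥ u = 0) : (alignedRoot D K X).PosDef := by
  rw [alignedRoot_posDef_iff hK]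
  intro h0
  obtain ⟨v, hv, hv0⟩ := exists_mulVec_eq_zero_iff.2 h0
  have hM := posSemidef_conjTranspose_mul_self (Xᵀ * D)
  rw [← conjTranspose_eq_transpose_of_trivial (Xᵀ * D), add_mulVec] at hv0
  have h1 := hM.dotProduct_mulVec_nonneg v
  have h2 := hK.dotProduct_mulVec_nonneg v
  have h3 : star v ⬝ᵥ ((Xᵀ * D)ᴴ * (Xᵀ * D)) *ᵥ v + star v ⬝ᵥ K *ᵥ v = 0 := by
    rw [← dotProduct_add, hv0, dotProduct_zero]
  have h4 := (hM.dotProduct_mulVec_zero_iff v).1 (by linarith)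
  have h5 := (hK.dotProduct_mulVec_zero_iff v).1 (by linarith)
  exact hv (hDK v (hX v ((conjTranspose_mul_self_mulVec_eq_zero _ _).1 h4)) h5)

theorem eventually_alignedRoot_posDef (hK : K.PosSemidef) {X : Matrix (Fin n) (Fin k) ℝ}
    (hX : (alignedRoot D K X).PosDef) : ∀ᶠ Y in 𝓝 X, (alignedRoot D K Y).PosDef := by
  simp only [alignedRoot_posDef_iff hK] at hX ⊢
  have hc : Continuous fun Y : Matrix (Fin n) (Fin k) ℝ =>
      ((Yᵀ * D)ᵀ * (Yᵀ * D) + K).det := by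
    have h : Continuous fun Y : Matrix (Fin n) (Fin k) ℝ => Yᵀ * D :=
      continuous_id.matrix_transpose.matrix_mul continuous_const
    exact ((h.matrix_transpose.matrix_mul h).add continuous_const).matrix_det
  exact hc.continuousAt.eventually_ne hX

theorem differentiableAt_alignedRoot (hK : K.PosSemidef) {X : Matrix (Fin n) (Fin k) ℝ}
    (hX : (alignedRoot D K X).PosDef) : DifferentiableAt ℝ (alignedRoot D K) X := by
  have h : DifferentiableAt ℝ (fun Y : Matrix (Fin n) (Fin k) ℝ => Yᵀ * D) X :=
    (differentiableAt_id (𝕜 := ℝ) (x := X)).matrix_transpose'.matrix_mul'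
      (differentiableAt_const D)
  have hC : DifferentiableAt ℝ
      (fun Y : Matrix (Fin n) (Fin k) ℝ => (Yᵀ * D)ᵀ * (Yᵀ * D) + K) X :=
    (h.matrix_transpose'.matrix_mul' h).add (differentiableAt_const K)
  exact hC.of_posDef_mul_self (alignedRoot_posSemidef hK) (alignedRoot_mul_self hK) hX

theorem differentiableAt_alignedKernel (hK : K.PosSemidef) {X : Matrix (Fin n) (Fin k) ℝ}
    (hX : (alignedRoot D K X).PosDef) : DifferentiableAt ℝ (alignedKernel D K) X :=
  ((differentiableAt_const D).matrix_mul'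
    ((differentiableAt_alignedRoot hK hX).matrix_inv hX.isUnit)).matrix_mul'
    (differentiableAt_const Dᵀ)

/-- For N = (XQ)ᵀD the cross terms NK and KN vanish and N² = NᵀN = DᵀXXᵀD, so N + K squares to the
matrix under the root; uniqueness of the semidefinite root finishes. -/
theorem alignedRoot_eq_add (hK : K.PosSemidef) (hKK : K * K = K) (hDK : D * K = 0)
    {X : Matrix (Fin n) (Fin k) ℝ} {Q : Matrix (Fin k) (Fin k) ℝ} (hQ : Q ∈ stiefel k k)
    (hN : ((X * Q)ᵀ * D).PosSemidef) : alignedRoot D K X = (X * Q)ᵀ * D + K := by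
  have hNt : ((X * Q)ᵀ * D)ᵀ = (X * Q)ᵀ * D := by
    have := hN.isHermitian.eq
    rwa [conjTranspose_eq_transpose_of_trivial] at this
  have hKt : Kᵀ = K := by
    have := hK.isHermitian.eq
    rwa [conjTranspose_eq_transpose_of_trivial] at this
  have h1 : (X * Q)ᵀ * D * K = 0 := by rw [Matrix.mul_assoc, hDK, Matrix.mul_zero]
  have h2 : K * ((X * Q)ᵀ * D) = 0 := by
    rw [← hNt, ← hKt, ← transpose_mul, h1, transpose_zero]
  have h3 : (X * Q)ᵀ * D * ((X * Q)ᵀ * D) = (Xᵀ * D)ᵀ * (Xᵀ * D) := by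
    rw [show (X * Q)ᵀ * D * ((X * Q)ᵀ * D) = ((X * Q)ᵀ * D)ᵀ * ((X * Q)ᵀ * D) by rw [hNt]]
    simp only [transpose_mul, transpose_transpose, Matrix.mul_assoc]
    rw [← Matrix.mul_assoc Q, mul_transpose_of_mem_stiefel hQ, Matrix.one_mul]
  have h4 : ((X * Q)ᵀ * D + K) * ((X * Q)ᵀ * D + K) = (Xᵀ * D)ᵀ * (Xᵀ * D) + K := by
    rw [Matrix.add_mul, Matrix.mul_add, Matrix.mul_add, h1, h2, hKK, h3, add_zero, zero_add]
  rw [alignedRoot, ← h4, psdSqrt_of_mul_self (hN.add hK)]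

/-- The left side seems to depend on Q, the right side does not. With N = (XQ)ᵀD = P - K one has D =
DP⁻¹N, and writing N = Nᵀ = DᵀXQ lets Q cancel against Qᵀ. -/
theorem mul_transpose_eq_alignedKernel (hK : K.PosSemidef) (hKK : K * K = K) (hDK : D * K = 0)
    {X : Matrix (Fin n) (Fin k) ℝ} {Q : Matrix (Fin k) (Fin k) ℝ} (hQ : Q ∈ stiefel k k)
    (hN : ((X * Q)ᵀ * D).PosSemidef) (hX : (alignedRoot D K X).PosDef) :
    D * (X * Q)ᵀ = alignedKernel D K X * X * Xᵀ := by
  have hNt : ((X * Q)ᵀ * D)ᵀ = (X * Q)ᵀ * D := by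
    have := hN.isHermitian.eq
    rwa [conjTranspose_eq_transpose_of_trivial] at this
  have hP := alignedRoot_eq_add hK hKK hDK hQ hN
  have hdet : IsUnit (alignedRoot D K X).det := (isUnit_iff_isUnit_det _).1 hX.isUnit
  have h1 : alignedRoot D K X * K = K := by
    rw [hP, Matrix.add_mul, Matrix.mul_assoc, hDK, Matrix.mul_zero, zero_add, hKK]
  have h2 : (alignedRoot D K X)⁻¹ * K = K := by
    have := nonsing_inv_mul_cancel_left K (A := alignedRoot D K X) hdet
    rwa [h1] at this
  have h3 : D = D * (alignedRoot D K X)⁻¹ * ((X * Q)ᵀ * D) := by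
    have : (X * Q)ᵀ * D = alignedRoot D K X - K := by rw [hP, add_sub_cancel_right]
    rw [this, Matrix.mul_sub, Matrix.mul_assoc, nonsing_inv_mul _ hdet, Matrix.mul_assoc, h2,
      hDK, sub_zero, Matrix.mul_one]
  conv_lhs => rw [h3, ← hNt]
  rw [alignedKernel, transpose_mul, transpose_transpose, transpose_mul]
  simp only [Matrix.mul_assoc]
  rw [← Matrix.mul_assoc Q, mul_transpose_of_mem_stiefel hQ, Matrix.one_mul]

end Alignment

/-! ### The aligned coefficient matrix as a differentiable function of X. -/

section AlignedCoeff

variable {n k : ℕ} {φ ψ : Matrix (Fin n) (Fin k) ℝ → ℝ}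
  {Hφ Hψ : Matrix (Fin n) (Fin k) ℝ → Matrix (Fin n) (Fin n) ℝ}
  {D : Matrix (Fin n) (Fin k) ℝ} {K : Matrix (Fin k) (Fin k) ℝ}

/-- A closed form of the aligned coefficient matrix. -/
noncomputable def kernelCoeff (ψ : Matrix (Fin n) (Fin k) ℝ → ℝ)
    (Hφ Hψ : Matrix (Fin n) (Fin k) ℝ → Matrix (Fin n) (Fin n) ℝ)
    (D : Matrix (Fin n) (Fin k) ℝ) (K : Matrix (Fin k) (Fin k) ℝ)
    (X : Matrix (Fin n) (Fin k) ℝ) : Matrix (Fin n) (Fin n) ℝ :=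
  Hφ X + (alignedKernel D K X * X * Xᵀ).trace • Hψ X +
    ψ X • (alignedKernel D K X * X * Xᵀ + (alignedKernel D K X * X * Xᵀ)ᵀ)

theorem coeffMatrix_eq_kernelCoeff (hφ : RightUnitarilyInvariant φ)
    (hψ : RightUnitarilyInvariant ψ) (hHφ : RightUnitarilyInvariant Hφ)
    (hHψ : RightUnitarilyInvariant Hψ) (hK : K.PosSemidef) (hKK : K * K = K) (hDK : D * K = 0)
    {X Y : Matrix (Fin n) (Fin k) ℝ} (hX : 0 < ψ X) (hP : (alignedRoot D K X).PosDef)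
    (hY : Y ∈ alignments (objective φ ψ D) X) :
    coeffMatrix ψ Hφ Hψ D Y = kernelCoeff ψ Hφ Hψ D K X := by
  obtain ⟨Q, hQ, rfl, hN⟩ := posSemidef_of_mem_alignments hφ hψ hX hY
  have hW := mul_transpose_eq_alignedKernel hK hKK hDK hQ hN hP
  rw [coeffMatrix, kernelCoeff, hHφ X Q hQ, hHψ X Q hQ, hψ X Q hQ, trace_mul_comm, ← hW,
    transpose_mul D, transpose_transpose]

theorem alignedCoeff_eq_coeffMatrix (hφ : RightUnitarilyInvariant φ)
    (hψ : RightUnitarilyInvariant ψ) (hHφ : RightUnitarilyInvariant Hφ)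
    (hHψ : RightUnitarilyInvariant Hψ) (hK : K.PosSemidef) (hKK : K * K = K) (hDK : D * K = 0)
    {X Y : Matrix (Fin n) (Fin k) ℝ} (hX : 0 < ψ X) (hP : (alignedRoot D K X).PosDef)
    (hY : Y ∈ alignments (objective φ ψ D) X) :
    alignedCoeff φ ψ Hφ Hψ D X = coeffMatrix ψ Hφ Hψ D Y := by
  have hne : (alignments (objective φ ψ D) X).Nonempty := ⟨Y, hY⟩
  rw [alignedCoeff, dif_pos hne,
    coeffMatrix_eq_kernelCoeff hφ hψ hHφ hHψ hK hKK hDK hX hP hne.some_mem,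
    coeffMatrix_eq_kernelCoeff hφ hψ hHφ hHψ hK hKK hDK hX hP hY]

theorem alignedCoeff_eq_kernelCoeff (hφ : RightUnitarilyInvariant φ)
    (hψ : RightUnitarilyInvariant ψ) (hHφ : RightUnitarilyInvariant Hφ)
    (hHψ : RightUnitarilyInvariant Hψ) (hK : K.PosSemidef) (hKK : K * K = K) (hDK : D * K = 0)
    {X : Matrix (Fin n) (Fin k) ℝ} (hX : 0 < ψ X) (hP : (alignedRoot D K X).PosDef) :
    alignedCoeff φ ψ Hφ Hψ D X = kernelCoeff ψ Hφ Hψ D K X := by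
  obtain ⟨Y, hY⟩ := alignments_nonempty hφ hψ D X
  rw [alignedCoeff_eq_coeffMatrix hφ hψ hHφ hHψ hK hKK hDK hX hP hY,
    coeffMatrix_eq_kernelCoeff hφ hψ hHφ hHψ hK hKK hDK hX hP hY]

theorem differentiableAt_kernelCoeff (hK : K.PosSemidef) {X : Matrix (Fin n) (Fin k) ℝ}
    (hP : (alignedRoot D K X).PosDef) (hψ : DifferentiableAt ℝ ψ X)
    (hHφ : DifferentiableAt ℝ Hφ X) (hHψ : DifferentiableAt ℝ Hψ X) :
    DifferentiableAt ℝ (kernelCoeff ψ Hφ Hψ D K) X := by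
  have hid : DifferentiableAt ℝ (fun Y : Matrix (Fin n) (Fin k) ℝ => Y) X := differentiableAt_id
  have hW := ((differentiableAt_alignedKernel hK hP).matrix_mul' hid).matrix_mul'
    hid.matrix_transpose'
  exact (hHφ.add (hW.matrix_trace'.smul hHψ)).add (hψ.smul (hW.add hW.matrix_transpose'))

theorem coeffMatrix_isSymm (hHφ : ∀ X, (Hφ X).IsSymm) (hHψ : ∀ X, (Hψ X).IsSymm)
    (X : Matrix (Fin n) (Fin k) ℝ) : (coeffMatrix ψ Hφ Hψ D X).IsSymm := by
  simp only [IsSymm, coeffMatrix, transpose_add, transpose_smul, (hHφ X).eq, (hHψ X).eq,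
    transpose_mul, transpose_transpose]
  rw [add_comm (X * Dᵀ)]

/-- The action of the closed form on `X`, tested against a tangent direction. -/
theorem trace_transpose_mul_kernelCoeff_mul (hHφ : IsGradientFactor φ Hφ)
    (hHψ : IsGradientFactor ψ Hψ) (hK : K.PosSemidef) {X : Matrix (Fin n) (Fin k) ℝ}
    (hX : X ∈ stiefel n k) {A : Matrix (Fin n) (Fin n) ℝ} (hA : Aᵀ = -A) :
    ((A * X)ᵀ * kernelCoeff ψ Hφ Hψ D K X * X).trace =
      ((A * X)ᵀ * matrixGradient φ X).trace +
      (alignedKernel D K X * X * Xᵀ).trace * ((A * X)ᵀ * matrixGradient ψ X).trace +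
      ψ X * ((A * X)ᵀ * (alignedKernel D K X * X)).trace := by
  set E := alignedKernel D K X with hE
  have hEs : Eᵀ = E := (alignedKernel_isSymm hK X).eq
  -- The term (EXXᵀ)ᵀX = XXᵀEX drops out: it pairs the skew XᵀAᵀX with the symmetric XᵀEX.
  have h0 : ((A * X)ᵀ * (X * (Xᵀ * (E * X)))).trace = 0 := by
    rw [← Matrix.mul_assoc]
    refine trace_skew_mul_isSymm ?_ ?_
    · rw [transpose_mul, transpose_mul, hA, transpose_mul, transpose_transpose, transpose_neg,
        hA]
      simp [Matrix.mul_assoc]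
    · rw [IsSymm, transpose_mul, transpose_mul, transpose_transpose, hEs, Matrix.mul_assoc]
  have hX1 : Xᵀ * X = 1 := hX
  have hXX : (X * Xᵀ)ᵀ = X * Xᵀ := by rw [transpose_mul, transpose_transpose]
  rw [hHφ.gradient_eq X hX, hHψ.gradient_eq X hX, Matrix.mul_assoc, kernelCoeff, ← hE]
  simp only [transpose_mul E, hXX, hEs, Matrix.add_mul,
    Matrix.smul_mul, Matrix.mul_add, Matrix.mul_smul, trace_add, trace_smul, smul_eq_mul,
    Matrix.mul_assoc, hX1, Matrix.mul_one, h0, add_zero]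

end AlignedCoeff

/-! ### Second-order optimality of the orbit maximum. -/

section SecondOrder

variable {n k : ℕ} {φ ψ : Matrix (Fin n) (Fin k) ℝ → ℝ}
  {Hφ Hψ : Matrix (Fin n) (Fin k) ℝ → Matrix (Fin n) (Fin n) ℝ}
  {D : Matrix (Fin n) (Fin k) ℝ} {K : Matrix (Fin k) (Fin k) ℝ}

/-- Differentiate P² = DᵀXXᵀD + K, multiply by P⁻¹ and take traces: the left side becomes 2 tr P',
with no Lyapunov equation to solve. -/
theorem hasDerivAt_trace_alignedRoot (hK : K.PosSemidef)
    {γ : ℝ → Matrix (Fin n) (Fin k) ℝ} {V : Matrix (Fin n) (Fin k) ℝ} {t : ℝ}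
    (hγ : HasDerivAt γ V t) (hP : (alignedRoot D K (γ t)).PosDef) :
    HasDerivAt (fun s => (alignedRoot D K (γ s)).trace)
      (Vᵀ * (alignedKernel D K (γ t) * γ t)).trace t := by
  have hd := (differentiableAt_alignedRoot hK hP).hasFDerivAt.comp_hasDerivAt t hγ
  set P' := fderiv ℝ (alignedRoot D K) (γ t) V with hP'
  change HasDerivAt (fun s => alignedRoot D K (γ s)) P' t at hd
  have h1 := hd.matrix_mul' hd
  simp only [alignedRoot_mul_self hK] at h1
  have hM := hγ.matrix_transpose'.matrix_mul' (hasDerivAt_const t D)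
  have h2 := (hM.matrix_transpose'.matrix_mul' hM).add (hasDerivAt_const t K)
  have h3 := h1.unique h2
  rw [Matrix.mul_zero, zero_add, add_zero] at h3
  set P := alignedRoot D K (γ t) with hPdef
  have hPt : Pᵀ = P := by
    have := hP.isHermitian.eq
    rwa [conjTranspose_eq_transpose_of_trivial] at this
  have hdet : IsUnit P.det := (isUnit_iff_isUnit_det _).1 hP.isUnit
  have h4 : (P⁻¹ * (P * P' + P' * P)).trace = 2 * P'.trace := by
    rw [Matrix.mul_add, trace_add, nonsing_inv_mul_cancel_left _ _ hdet, trace_mul_comm,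
      Matrix.mul_assoc, mul_nonsing_inv _ hdet, Matrix.mul_one]
    ring
  have h5 : (P⁻¹ * (((γ t)ᵀ * D)ᵀ * (Vᵀ * D))).trace =
      (Vᵀ * (alignedKernel D K (γ t) * γ t)).trace := by
    rw [alignedKernel, ← hPdef, transpose_mul, transpose_transpose, ← Matrix.mul_assoc,
      ← Matrix.mul_assoc, trace_mul_comm, trace_mul_comm Vᵀ]
    simp only [Matrix.mul_assoc]
  have h6 : (P⁻¹ * ((Vᵀ * D)ᵀ * ((γ t)ᵀ * D))).trace =
      (Vᵀ * (alignedKernel D K (γ t) * γ t)).trace := by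
    rw [← h5, ← trace_transpose, transpose_mul, transpose_nonsing_inv, hPt, transpose_mul,
      transpose_transpose, trace_mul_comm]
  have h7 : P'.trace = (Vᵀ * (alignedKernel D K (γ t) * γ t)).trace := by
    rw [h3, Matrix.mul_add, trace_add, h5, h6] at h4
    linarith
  rw [← h7]
  exact hd.matrix_trace'

/-- Expresses the optimal trace over the orbit through P, which is smooth where positive definite
although the optimal Q may not be. -/
theorem exists_alignment_trace (hφ : RightUnitarilyInvariant φ)
    (hψ : RightUnitarilyInvariant ψ) (hK : K.PosSemidef) (hKK : K * K = K) (hDK : D * K = 0)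
    {X : Matrix (Fin n) (Fin k) ℝ} (hX : 0 < ψ X) :
    ∃ Q ∈ stiefel k k, ((X * Q)ᵀ * D).trace = (alignedRoot D K X).trace - K.trace ∧
      ((alignedRoot D K X).PosDef → (alignedKernel D K X * X * Xᵀ).trace =
        (alignedRoot D K X).trace - K.trace) := by
  obtain ⟨Y, hY⟩ := alignments_nonempty hφ hψ D X
  obtain ⟨Q, hQ, rfl, hN⟩ := posSemidef_of_mem_alignments hφ hψ hX hY
  have h1 : ((X * Q)ᵀ * D).trace = (alignedRoot D K X).trace - K.trace := by
    rw [alignedRoot_eq_add hK hKK hDK hQ hN, trace_add, add_sub_cancel_right]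
  refine ⟨Q, hQ, h1, fun hP => ?_⟩
  rw [← mul_transpose_eq_alignedKernel hK hKK hDK hQ hN hP, trace_mul_comm, h1]

/-- A function with a local maximum at `x` has a nonpositive second derivative there. -/
theorem IsLocalMax.second_deriv_nonpos {h v : ℝ → ℝ} {x a : ℝ} (hm : IsLocalMax h x)
    (hd : ∀ᶠ t in 𝓝 x, HasDerivAt h (v t) t) (hv : HasDerivAt v a x) : a ≤ 0 := by
  by_contra! ha
  have he : deriv h =ᶠ[𝓝 x] v := hd.mono fun t ht => ht.deriv
  have h2 : deriv (deriv h) x = a := by rw [he.deriv_eq, hv.deriv]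
  -- A positive second derivative makes x a local minimum as well, so h is locally constant and its
  -- second derivative is 0.
  have hmin := isLocalMin_of_deriv_deriv_pos (by rw [h2]; exact ha) hm.deriv_eq_zero
    hd.self_of_nhds.continuousAt
  have hc : h =ᶠ[𝓝 x] fun _ => h x := by
    filter_upwards [hm, hmin] with y h1 h2 using le_antisymm h1 h2
  have h3 : deriv h =ᶠ[𝓝 x] fun _ => 0 := by
    filter_upwards [hc.eventually_nhds] with y hy
    rw [Filter.EventuallyEq.deriv_eq hy, deriv_const]
  rw [h3.deriv_eq, deriv_const] at h2
  exact ha.ne h2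

/-- Second-order optimality along the curves `exp(t A) X`. -/
theorem second_order_condition (hφ : RightUnitarilyInvariant φ)
    (hψ : RightUnitarilyInvariant ψ) (hHφ : IsGradientFactor φ Hφ)
    (hHψ : IsGradientFactor ψ Hψ) (hK : K.PosSemidef) (hKK : K * K = K) (hDK : D * K = 0)
    (hφd : ∀ X ∈ stiefel n k, DifferentiableAt ℝ φ X)
    (hψd : ∀ X ∈ stiefel n k, DifferentiableAt ℝ ψ X) (hpos : ∀ X ∈ stiefel n k, 0 < ψ X)
    {X : Matrix (Fin n) (Fin k) ℝ}
    (hX : X ∈ stiefel n k) (hmax : IsMaxOn (objective φ ψ D) (stiefel n k) X)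
    (hP : (alignedRoot D K X).PosDef)
    (hG : DifferentiableAt ℝ (alignedCoeff φ ψ Hφ Hψ D) X)
    {A : Matrix (Fin n) (Fin n) ℝ} (hA : Aᵀ = -A) :
    ((A * (A * X))ᵀ * alignedCoeff φ ψ Hφ Hψ D X * X).trace +
      ((A * X)ᵀ * fderiv ℝ (alignedCoeff φ ψ Hφ Hψ D) X (A * X) * X).trace +
      ((A * X)ᵀ * alignedCoeff φ ψ Hφ Hψ D X * (A * X)).trace ≤ 0 := by
  set G := alignedCoeff φ ψ Hφ Hψ D with hGdef
  have hγ := hasDerivAt_exp_smul_mul A X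
  have hmem := exp_smul_mul_mem_stiefel hA hX
  set γ : ℝ → Matrix (Fin n) (Fin k) ℝ := fun t => NormedSpace.exp (t • A) * X with hγd
  have h0 : γ 0 = X := by simp [hγd]
  replace hγ : ∀ t, HasDerivAt γ (A * γ t) t := hγ
  replace hmem : ∀ t, γ t ∈ stiefel n k := hmem
  -- The maximum of the objective over the orbit of γ(t); `v` will be its derivative near 0.
  set h : ℝ → ℝ := fun t => φ (γ t) + ψ (γ t) * ((alignedRoot D K (γ t)).trace - K.trace)
  set v : ℝ → ℝ := fun t => ((A * γ t)ᵀ * G (γ t) * γ t).trace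
  have hle : ∀ t, h t ≤ objective φ ψ D X := fun t => by
    obtain ⟨Q, hQ, h1, -⟩ := exists_alignment_trace (D := D) hφ hψ hK hKK hDK (hpos _ (hmem t))
    have h2 : objective φ ψ D (γ t * Q) ≤ objective φ ψ D X :=
      hmax (mul_mem_stiefel (hmem t) hQ)
    rwa [objective_mul hφ hψ D _ hQ, h1] at h2
  have heq : h 0 = objective φ ψ D X := by
    refine le_antisymm (hle 0) ?_
    obtain ⟨Q, hQ, hXQ, hN⟩ :=
      posSemidef_of_mem_alignments hφ hψ (hpos X hX) (self_mem_alignments hX hmax)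
    have h1 := alignedRoot_eq_add hK hKK hDK hQ (hXQ ▸ hN)
    simp only [h, h0, h1, trace_add, add_sub_cancel_right]
    rw [← hXQ, objective]
  have hm : IsLocalMax h 0 := Filter.Eventually.of_forall fun t => by
    rw [heq]; exact hle t
  have hd : ∀ᶠ t in 𝓝 (0 : ℝ), HasDerivAt h (v t) t := by
    have hc : Filter.Tendsto γ (𝓝 0) (𝓝 X) := by
      have := (hγ 0).continuousAt.tendsto
      rwa [h0] at this
    filter_upwards [hc.eventually (eventually_alignedRoot_posDef hK hP)] with t ht
    obtain ⟨Q, hQ, -, h1⟩ :=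
      exists_alignment_trace (D := D) hφ hψ hK hKK hDK (hpos _ (hmem t))
    have hχ {χ : Matrix (Fin n) (Fin k) ℝ → ℝ} (hχ : DifferentiableAt ℝ χ (γ t)) :
        HasDerivAt (fun t => χ (γ t)) ((A * γ t)ᵀ * matrixGradient χ (γ t)).trace t := by
      rw [← fderiv_apply_eq_trace]
      exact hχ.hasFDerivAt.comp_hasDerivAt t (hγ t)
    have h2 := (hχ (hφd _ (hmem t))).add ((hχ (hψd _ (hmem t))).mul
      ((hasDerivAt_trace_alignedRoot hK (hγ t) ht).sub_const K.trace))
    refine h2.congr_deriv ?_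
    simp only [v, hGdef]
    rw [alignedCoeff_eq_kernelCoeff hφ hψ hHφ.invariant hHψ.invariant hK hKK hDK
      (hpos _ (hmem t)) ht, trace_transpose_mul_kernelCoeff_mul hHφ hHψ hK (hmem t) hA, h1 ht]
    ring
  have hv : HasDerivAt v (((A * (A * X))ᵀ * G X * X).trace +
      ((A * X)ᵀ * fderiv ℝ G X (A * X) * X).trace + ((A * X)ᵀ * G X * (A * X)).trace) 0 := by
    have hγ0 := hγ 0
    have hGγ : HasDerivAt (fun t => G (γ t)) (fderiv ℝ G X (A * X)) 0 := by
      have hF : HasFDerivAt G (fderiv ℝ G X) (γ 0) := by rw [h0]; exact hG.hasFDerivAt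
      rw [h0] at hγ0
      exact hF.comp_hasDerivAt (0 : ℝ) hγ0
    have hAγ := ((hasDerivAt_const (0 : ℝ) A).matrix_mul' hγ0).matrix_transpose'
    have := ((hAγ.matrix_mul' hGγ).matrix_mul' hγ0).matrix_trace'
    refine this.congr_deriv ?_
    rw [h0, Matrix.zero_mul, add_zero, Matrix.add_mul, trace_add, trace_add]
    ring
  exact hm.second_deriv_nonpos hd hv

end SecondOrder

/-! ### Block decomposition with respect to [X, X_⊥]. -/

section Blocks

variable {n k : ℕ}

/-- Makes the truncated `n - k` a true difference, so that the two blocks fill a square matrix. -/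
theorem le_of_mem_stiefel {X : Matrix (Fin n) (Fin k) ℝ} (hX : X ∈ stiefel n k) : k ≤ n := by
  have h1 := rank_mul_le_right Xᵀ X
  rw [mem_stiefel_iff.1 hX, rank_one, Fintype.card_fin] at h1
  exact h1.trans (by simpa using X.rank_le_height)

/-- Completeness of an orthonormal basis that is split into two blocks. -/
theorem mul_transpose_add_mul_transpose_eq_one {X : Matrix (Fin n) (Fin k) ℝ}
    {Xp : Matrix (Fin n) (Fin (n - k)) ℝ} (hX : X ∈ stiefel n k) (hXp : Xp ∈ stiefel n (n - k))
    (h : Xᵀ * Xp = 0) : X * Xᵀ + Xp * Xpᵀ = 1 := by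
  have hkn := le_of_mem_stiefel hX
  have h' : Xpᵀ * X = 0 := by
    rw [← transpose_transpose X, ← transpose_mul, h, transpose_zero]
  have h1 : fromRows Xᵀ Xpᵀ * fromCols X Xp = 1 := by
    rw [fromRows_mul_fromCols, mem_stiefel_iff.1 hX, mem_stiefel_iff.1 hXp, h, h',
      fromBlocks_one]
  have e : Fin k ⊕ Fin (n - k) ≃ Fin n :=
    finSumFinEquiv.trans (finCongr (by omega))
  have h2 := (mul_eq_one_comm_of_equiv e).1 h1
  rwa [fromCols_mul_fromRows] at h2

theorem eq_block_decomposition {X : Matrix (Fin n) (Fin k) ℝ}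
    {Xp : Matrix (Fin n) (Fin (n - k)) ℝ} (hX : X ∈ stiefel n k) (hXp : Xp ∈ stiefel n (n - k))
    (h : Xᵀ * Xp = 0) {G : Matrix (Fin n) (Fin n) ℝ} (hG : G.IsSymm) (h0 : Xpᵀ * G * X = 0) :
    G = X * (Xᵀ * G * X) * Xᵀ + Xp * (Xpᵀ * G * Xp) * Xpᵀ := by
  have h1 := mul_transpose_add_mul_transpose_eq_one hX hXp h
  have h0' : Xᵀ * G * Xp = 0 := by
    have := congrArg transpose h0
    rwa [transpose_mul, transpose_mul, transpose_transpose, hG.eq, transpose_zero,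
      ← Matrix.mul_assoc] at this
  calc G = (X * Xᵀ + Xp * Xpᵀ) * G * (X * Xᵀ + Xp * Xpᵀ) := by
        rw [h1, Matrix.one_mul, Matrix.mul_one]
    _ = X * (Xᵀ * G * X) * Xᵀ + Xp * (Xpᵀ * G * X) * Xᵀ + (X * (Xᵀ * G * Xp) * Xpᵀ +
          Xp * (Xpᵀ * G * Xp) * Xpᵀ) := by
        simp only [Matrix.add_mul, Matrix.mul_add, Matrix.mul_assoc]
    _ = _ := by rw [h0, h0']; simp

/-- First-order optimality in terms of the coefficient matrix. -/
theorem transpose_mul_coeffMatrix_mul_eq_zero {φ ψ : Matrix (Fin n) (Fin k) ℝ → ℝ}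
    {Hφ Hψ : Matrix (Fin n) (Fin k) ℝ → Matrix (Fin n) (Fin n) ℝ}
    {D X : Matrix (Fin n) (Fin k) ℝ} {m : ℕ} {Xp : Matrix (Fin n) (Fin m) ℝ}
    (hφ : RightUnitarilyInvariant φ) (hψ : RightUnitarilyInvariant ψ)
    (hHφ : IsGradientFactor φ Hφ) (hHψ : IsGradientFactor ψ Hψ)
    (hφd : DifferentiableAt ℝ φ X) (hψd : DifferentiableAt ℝ ψ X)
    (hX : X ∈ stiefel n k) (hmax : IsMaxOn (objective φ ψ D) (stiefel n k) X)
    (h : Xᵀ * Xp = 0) : Xpᵀ * coeffMatrix ψ Hφ Hψ D X * X = 0 := by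
  -- Testing stationarity in the direction X_⊥W itself gives tr(WᵀW) = 0.
  set W := Xpᵀ * coeffMatrix ψ Hφ Hψ D X * X with hW
  have hV : Xᵀ * (Xp * W) = 0 := by rw [← Matrix.mul_assoc, h, Matrix.zero_mul]
  have hV' : (Xp * W)ᵀ * X = 0 := by
    rw [← transpose_transpose X, ← transpose_mul, hV, transpose_zero]
  have hfo := first_order_condition hφ hψ hφd hψd hX hmax hV one_mem_stiefel (by simp)
  have hX1 : Xᵀ * X = 1 := hX
  have htr : (Wᵀ * W).trace = 0 := by
    have h1 : Wᵀ * W = (Xp * W)ᵀ * matrixGradient φ X +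
        (Xᵀ * D).trace • ((Xp * W)ᵀ * matrixGradient ψ X) + ψ X • ((Xp * W)ᵀ * D) := by
      conv_lhs => rhs; rw [hW]
      rw [coeffMatrix, hHφ.gradient_eq X hX, hHψ.gradient_eq X hX, Matrix.mul_assoc Xpᵀ,
        ← Matrix.mul_assoc Wᵀ, ← transpose_mul]
      simp only [Matrix.add_mul, Matrix.smul_mul, Matrix.mul_add, Matrix.mul_smul,
        Matrix.mul_assoc, hX1, Matrix.mul_one]
      rw [← Matrix.mul_assoc _ X, hV', Matrix.zero_mul, add_zero]
    rw [h1, trace_add, trace_add, trace_smul, trace_smul, smul_eq_mul, smul_eq_mul]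
    rwa [Matrix.mul_one] at hfo
  rw [← conjTranspose_eq_transpose_of_trivial] at htr
  exact trace_conjTranspose_mul_self_eq_zero_iff.1 htr

end Blocks

/-! ### Assembly of the main theorem. -/

theorem theorem5p1 (n k : ℕ) (φ ψ : Matrix (Fin n) (Fin k) ℝ → ℝ)
    (D Xs : Matrix (Fin n) (Fin k) ℝ) (Xp : Matrix (Fin n) (Fin (n - k)) ℝ)
    -- the standing assumptions on the two functions
    (hφ_inv : RightUnitarilyInvariant φ) (hψ_inv : RightUnitarilyInvariant ψ)
    (hφ_C1 : ∀ X ∈ stiefel n k, ContDiffAt ℝ 1 φ X)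
    (hψ_C1 : ∀ X ∈ stiefel n k, ContDiffAt ℝ 1 ψ X)
    (hψ_pos : ∀ X ∈ stiefel n k, 0 < ψ X)
    -- a global maximizer on the Stiefel manifold
    (hXs : Xs ∈ stiefel n k) (hmax : IsMaxOn (objective φ ψ D) (stiefel n k) Xs)
    -- second-order differentiability of both functions
    (hφ_twice : DifferentiableAt ℝ (fderiv ℝ φ) Xs)
    (hψ_twice : DifferentiableAt ℝ (fderiv ℝ ψ) Xs)
    -- the square matrix with the blocks `Xs` and `Xp` is orthogonal
    (hXp : Xp ∈ stiefel n (n - k)) (hXsXp : Xsᵀ * Xp = 0) :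
    -- admissible differentiable coefficient functions exist
    (∃ Hφ, IsGradientFactor φ Hφ ∧ DifferentiableAt ℝ Hφ Xs) ∧
    (∃ Hψ, IsGradientFactor ψ Hψ ∧ DifferentiableAt ℝ Hψ Xs) ∧
    -- and for every choice of them the following holds
    ∀ Hφ Hψ : Matrix (Fin n) (Fin k) ℝ → Matrix (Fin n) (Fin n) ℝ,
      IsGradientFactor φ Hφ → DifferentiableAt ℝ Hφ Xs →
      IsGradientFactor ψ Hψ → DifferentiableAt ℝ Hψ Xs →
      -- the aligned coefficient matrix is well defined near `Xs`
      (Xsᵀ * D).rank = D.rank ∧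
      (∀ᶠ X in 𝓝 Xs, (alignments (objective φ ψ D) X).Nonempty ∧
        ∀ Y ∈ alignments (objective φ ψ D) X,
          alignedCoeff φ ψ Hφ Hψ D X = coeffMatrix ψ Hφ Hψ D Y) ∧
      -- and differentiable at `Xs`
      DifferentiableAt ℝ (alignedCoeff φ ψ Hφ Hψ D) Xs ∧
      -- the block eigendecomposition at `Xs`
      alignedCoeff φ ψ Hφ Hψ D Xs =
        Xs * (Xsᵀ * alignedCoeff φ ψ Hφ Hψ D Xs * Xs) * Xsᵀ +
          Xp * (Xpᵀ * alignedCoeff φ ψ Hφ Hψ D Xs * Xp) * Xpᵀ ∧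
      -- the operator is negative semidefinite
      ∀ Z : Matrix (Fin (n - k)) (Fin k) ℝ,
        (Zᵀ * levelShiftOperator (alignedCoeff φ ψ Hφ Hψ D) Xs Xp Z).trace ≤ 0 := by
  have hφd : ∀ X ∈ stiefel n k, DifferentiableAt ℝ φ X := fun X hX =>
    (hφ_C1 X hX).differentiableAt one_ne_zero
  have hψd : ∀ X ∈ stiefel n k, DifferentiableAt ℝ ψ X := fun X hX =>
    (hψ_C1 X hX).differentiableAt one_ne_zero
  refine ⟨⟨gradientFactor φ, isGradientFactor_gradientFactor hφ_inv hφ_C1,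
      differentiableAt_gradientFactor hφ_twice⟩,
    ⟨gradientFactor ψ, isGradientFactor_gradientFactor hψ_inv hψ_C1,
      differentiableAt_gradientFactor hψ_twice⟩, ?_⟩
  intro Hφ Hψ hHφ hHφd hHψ hHψd
  have hker : ∀ u, (Xsᵀ * D) *ᵥ u = 0 → D *ᵥ u = 0 := fun u hu =>
    mulVec_eq_zero_of_maximizer hφ_inv hψ_inv (hφd Xs hXs) (hψd Xs hXs) (hψ_pos Xs hXs) hXs
      hmax hu
  obtain ⟨K, hK, hKK, hDK, hK0⟩ := exists_kernel_projection D
  have hP := alignedRoot_posDef_of_ker hK hK0 hker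
  -- The neighbourhood leaves the manifold, so positivity of ψ there comes from continuity.
  have hnear : ∀ᶠ X in 𝓝 Xs, 0 < ψ X ∧ (alignedRoot D K X).PosDef :=
    ((hψd Xs hXs).continuousAt.eventually (lt_mem_nhds (hψ_pos Xs hXs))).and
      (eventually_alignedRoot_posDef hK hP)
  have hGd : DifferentiableAt ℝ (alignedCoeff φ ψ Hφ Hψ D) Xs :=
    (differentiableAt_kernelCoeff hK hP (hψd Xs hXs) hHφd hHψd).congr_of_eventuallyEq
      (hnear.mono fun X hX => alignedCoeff_eq_kernelCoeff hφ_inv hψ_inv hHφ.invariant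
        hHψ.invariant hK hKK hDK hX.1 hX.2)
  have hGs : alignedCoeff φ ψ Hφ Hψ D Xs = coeffMatrix ψ Hφ Hψ D Xs :=
    alignedCoeff_eq_coeffMatrix hφ_inv hψ_inv hHφ.invariant hHψ.invariant hK hKK hDK
      (hψ_pos Xs hXs) hP (self_mem_alignments hXs hmax)
  refine ⟨rank_mul_eq_of_mulVec_eq_zero hker, hnear.mono fun X hX =>
    ⟨alignments_nonempty hφ_inv hψ_inv D X, fun Y hY => alignedCoeff_eq_coeffMatrix hφ_inv
      hψ_inv hHφ.invariant hHψ.invariant hK hKK hDK hX.1 hX.2 hY⟩, hGd, ?_, fun Z => ?_⟩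
  · rw [hGs]
    exact eq_block_decomposition hXs hXp hXsXp (coeffMatrix_isSymm hHφ.isSymm hHψ.isSymm Xs)
      (transpose_mul_coeffMatrix_mul_eq_zero hφ_inv hψ_inv hHφ hHψ (hφd Xs hXs) (hψd Xs hXs)
        hXs hmax hXsXp)
  · have hV : Xsᵀ * (Xp * Z) = 0 := by rw [← Matrix.mul_assoc, hXsXp, Matrix.zero_mul]
    have h2 := second_order_condition hφ_inv hψ_inv hHφ hHψ hK hKK hDK hφd hψd hψ_pos hXs hmax
      hP hGd (transpose_sub_transpose_skew (Xp * Z) Xs)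
    have hVV : (Xp * Z)ᵀ * (Xp * Z) = Zᵀ * Z := by
      rw [transpose_mul, Matrix.mul_assoc, ← Matrix.mul_assoc Xpᵀ, mem_stiefel_iff.1 hXp,
        Matrix.one_mul]
    -- The curve's acceleration A(AX_*) = -X_*ZᵀZ produces the term -ZΛ_* of the operator.
    have hAV : (Xp * Z * Xsᵀ - Xs * (Xp * Z)ᵀ) * (Xp * Z) = -(Xs * (Zᵀ * Z)) := by
      rw [Matrix.sub_mul, Matrix.mul_assoc _ Xsᵀ, hV, Matrix.mul_zero, Matrix.mul_assoc Xs, hVV,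
        zero_sub]
    rw [skew_mul_of_mem_stiefel hXs hV, hAV] at h2
    set G := alignedCoeff φ ψ Hφ Hψ D
    have hlev : levelShiftOperator G Xs Xp Z = (Xpᵀ * G Xs * Xp) * Z - Z * (Xsᵀ * G Xs * Xs) +
        Xpᵀ * fderiv ℝ G Xs (Xp * Z) * Xs := rfl
    rw [hlev]
    simp only [transpose_neg, transpose_mul, transpose_transpose, Matrix.neg_mul, trace_neg,
      Matrix.mul_add, Matrix.mul_sub, trace_add, trace_sub, Matrix.mul_assoc] at h2 ⊢
    linarith
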